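/- A multi-agent influence diagram (MAID) consists of a finite set of agents, a finite directed acyclic graph whose vertices are variables with finite domains of at least two values, partitioned into chance variables, decision variables $\bm D=\bigcup_i \bm D^i$ and utility variables $\bm U=\bigcup_i \bm U^i$ (with numerical values), and a conditional distribution $\Pr(V\mid \mathrm{Pa}_V)$ for each chance and utility variable, deterministic for utility variables. A (behavioural) policy $\pi^i$ of agent $i$ consists of a conditional distribution $\pi_D(D\mid \mathrm{Pa}_D)$ for each $D\in\bm D^i$, chosen separately for each $D$; $\pi^{-i}$ denotes a policy for each agent other than $i$. A profile $\pi$ of policies induces a joint distribution $\Pr^\pi$, the product of all conditional distributions, and $EU^i(\pi)=\sum_{U\in\bm U^i}\sum_{u\in \mathrm{dom}(U)}\Pr^\pi(U=u)\,u$. A best response to $\pi^{-i}$ is a policy $\pi^i$ with $EU^i(\pi^i,\pi^{-i})\ge EU^i(\varpi^i,\pi^{-i})$ for all policies $\varpi^i$ of agent $i$. In inputs and outputs, all distributions are given as complete tables of fractions of integers in binary notation, and utility values are fractions of integers in binary notation as well; running times are measured in the size of the input. Is-Best-Response is the problem to decide, given a MAID, an agent $i$, a partial profile $\pi^{-i}$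 and $q\in\mathbb Q$, whether some policy $\hat\pi^i$ has $EU^i(\hat\pi^i,\pi^{-i})>q$. Let $k,b\in\mathbb N$, and let $\mathcal C$ be a class of pairs (MAID, agent $i$), for instance the class of all such pairs, that is closed under replacing a decision variable of agent $i$ by a chance variable that follows a pure decision rule. Let $\mathcal C_{k,b}$ be the class of those pairs in $\mathcal C$ for which each $D\in\bm D^i$ has in-degree at most $k$, and each $D\in\bm D^i$ and each parent of such a $D$ has at most $b$ values. If Is-Best-Response restricted to $\mathcal C_{k,b}$ can be solved in polynomial time, then there is a polynomial-time algorithm that, given a member of $\mathcal C_{k,b}$ and a partial profile $\pi^{-i}$, outputs a best response policy of agent $i$ to $\pi^{-i}$. -/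

import Mathlib

/-! ## A machine model with a cost measure

Inputs, outputs and memory contents are binary trees. A machine has registers `0, 1, 2, …`, each
holding a tree, and runs a structured program. Every elementary instruction is charged one plus
the number of nodes of the tree that it writes, every test is charged one. Hence the total size of
all registers never exceeds the input size plus the time used (plus the number of registers), so
that this model and Turing machines simulate each other with polynomial overhead. -/

/-- Binary trees, the only data type of the machine. -/
inductive Data : Type
  | nil : Data
  | cons (l r : Data) : Data

namespace Data

/-- Number of nodes of a tree. -/
def size : Data → ℕ
  | nil => 1
  | cons l r => l.size + r.size + 1

/-- The head of a tree (`nil` for the empty tree). -/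
def head : Data → Data
  | nil => nil
  | cons l _ => l

/-- The tail of a tree (`nil` for the empty tree). -/
def tail : Data → Data
  | nil => nil
  | cons _ r => r

/-- A finite list of trees as a tree. -/
def ofList : List Data → Data
  | [] => nil
  | d :: ds => cons d (ofList ds)

/-- A bit. -/
def ofBool : Bool → Data
  | false => nil
  | true => cons nil nil

/-- A natural number in unary notation. -/
def unary (n : ℕ) : Data := ofList (List.replicate n nil)

/-- A natural number in binary notation, least significant bit first, without leading zeros. -/
def binary (n : ℕ) : Data := ofList (n.bits.map ofBool)

/-- An integer: its sign, and its absolute value in binary notation. -/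
def ofInt (z : ℤ) : Data := cons (ofBool (decide (z < 0))) (binary z.natAbs)

end Data

/-- Programs. `x`, `y`, `z` are register numbers. -/
inductive Cmd : Type
  /-- `x := nil` -/
  | setNil (x : ℕ) : Cmd
  /-- `x := y` -/
  | copy (x y : ℕ) : Cmd
  /-- `x := cons y z` -/
  | cons (x y z : ℕ) : Cmd
  /-- `x := head y` -/
  | head (x y : ℕ) : Cmd
  /-- `x := tail y` -/
  | tail (x y : ℕ) : Cmd
  /-- first `p`, then `q` -/
  | seq (p q : Cmd) : Cmd
  /-- if register `x` is not `nil` then `p` else `q` -/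
  | ite (x : ℕ) (p q : Cmd) : Cmd
  /-- while register `x` is not `nil` do `p` -/
  | loop (x : ℕ) (p : Cmd) : Cmd

/-- Memory contents. -/
abbrev Store : Type := ℕ → Data

/-- `Runs p s s' t`: started in memory `s`, the program `p` halts in memory `s'` at cost `t`. -/
inductive Runs : Cmd → Store → Store → ℕ → Prop
  | setNil (s : Store) (x : ℕ) :
      Runs (.setNil x) s (Function.update s x .nil) (1 + Data.nil.size)
  | copy (s : Store) (x y : ℕ) :
      Runs (.copy x y) s (Function.update s x (s y)) (1 + (s y).size)
  | cons (s : Store) (x y z : ℕ) :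
      Runs (.cons x y z) s (Function.update s x (.cons (s y) (s z)))
        (1 + (Data.cons (s y) (s z)).size)
  | head (s : Store) (x y : ℕ) :
      Runs (.head x y) s (Function.update s x (s y).head) (1 + (s y).head.size)
  | tail (s : Store) (x y : ℕ) :
      Runs (.tail x y) s (Function.update s x (s y).tail) (1 + (s y).tail.size)
  | seq {p q : Cmd} {s s' s'' : Store} {t t' : ℕ} :
      Runs p s s' t → Runs q s' s'' t' → Runs (.seq p q) s s'' (t + t')
  | iteTrue {x : ℕ} {p q : Cmd} {s s' : Store} {t : ℕ} :
      s x ≠ .nil → Runs p s s' t → Runs (.ite x p q) s s' (1 + t)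
  | iteFalse {x : ℕ} {p q : Cmd} {s s' : Store} {t : ℕ} :
      s x = .nil → Runs q s s' t → Runs (.ite x p q) s s' (1 + t)
  | loopDone {x : ℕ} {p : Cmd} {s : Store} :
      s x = .nil → Runs (.loop x p) s s 1
  | loopStep {x : ℕ} {p : Cmd} {s s' s'' : Store} {t t' : ℕ} :
      s x ≠ .nil → Runs p s s' t → Runs (.loop x p) s' s'' t' →
        Runs (.loop x p) s s'' (1 + t + t')

/-- The memory at the start of a computation: the input in register `0`, all others empty. -/
def initStore (d : Data) : Store := Function.update (fun _ => Data.nil) 0 d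

/-- On input `d`, the program `p` halts at cost at most `t` with output `e` in register `0`. -/
def Computes (p : Cmd) (d e : Data) (t : ℕ) : Prop :=
  ∃ s : Store, ∃ t' : ℕ, Runs p (initStore d) s t' ∧ s 0 = e ∧ t' ≤ t

/-- The decision problem `L`, restricted to the instances satisfying `valid`, can be solved in
polynomial time: some program accepts (output different from `nil`) exactly the valid instances
in `L`, in time polynomial in the size of the encoded instance. -/
def PolyTimeDecidable {α : Type} (enc : α → Data) (valid : α → Prop) (L : α → Prop) : Prop :=
  ∃ (p : Cmd) (P : Polynomial ℕ), ∀ a : α, valid a →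
    ∃ e : Data, Computes p (enc a) e (P.eval (enc a).size) ∧ (e ≠ .nil ↔ L a)

/-- The search problem `R`, restricted to the instances satisfying `valid`, can be solved in
polynomial time: some program outputs, for every valid instance `a`, the encoding of some `b` with
`R a b`, in time polynomial in the size of the encoded instance. -/
def PolyTimeSolvable {α : Type} {β : α → Type} (enc : α → Data) (encOut : (a : α) → β a → Data)
    (valid : α → Prop) (R : (a : α) → β a → Prop) : Prop :=
  ∃ (p : Cmd) (P : Polynomial ℕ), ∀ a : α, valid a →
    ∃ b : β a, R a b ∧ Computes p (enc a) (encOut a b) (P.eval (enc a).size)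

/-! ## Rational numbers and distributions as written on the input -/

/-- A fraction of two integers (not necessarily in lowest terms). -/
structure Frac : Type where
  num : ℤ
  den : ℕ
  den_pos : 0 < den

namespace Frac

/-- The value of a fraction. -/
noncomputable def toReal (q : Frac) : ℝ := (q.num : ℝ) / (q.den : ℝ)

/-- Numerator and denominator, both in binary notation. -/
def enc (q : Frac) : Data := .cons (.ofInt q.num) (.binary q.den)

/-- The fraction `n / 1`. -/
def ofNat (n : ℕ) : Frac := ⟨n, 1, Nat.one_pos⟩

end Frac

/-- A probability distribution on `Fin m` with rational probabilities. -/
structure RatDist (m : ℕ) : Type where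
  prob : Fin m → Frac
  mem_stdSimplex : (fun d => (prob d).toReal) ∈ stdSimplex ℝ (Fin m)

namespace RatDist

/-- A rational distribution as a real one. -/
noncomputable def toReal {m : ℕ} (p : RatDist m) : stdSimplex ℝ (Fin m) :=
  ⟨fun d => (p.prob d).toReal, p.mem_stdSimplex⟩

/-- The distribution concentrated in `d`. -/
def pure {m : ℕ} (d : Fin m) : RatDist m where
  prob e := Frac.ofNat (if e = d then 1 else 0)
  mem_stdSimplex := by
    constructor
    · intro e
      simp only [Frac.toReal, Frac.ofNat]
      positivity
    · simp [Frac.toReal, Frac.ofNat]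

/-- The list of all probabilities. -/
def enc {m : ℕ} (p : RatDist m) : Data := .ofList (List.ofFn fun d => (p.prob d).enc)

end RatDist

/-! ## Multi-agent influence diagrams -/

/-- A set of agents, a set of variables with their finite, non-singleton domains, and a directed
acyclic graph on the variables, given by the list of the parents of each variable. -/
structure Diagram : Type where
  numAgents : ℕ
  numVars : ℕ
  dom : Fin numVars → ℕ
  two_le_dom : ∀ v, 2 ≤ dom v
  parents : Fin numVars → List (Fin numVars)
  parents_nodup : ∀ v, (parents v).Nodup
  acyclic : ∀ v, ¬ Relation.TransGen (fun u w => u ∈ parents w) v v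

namespace Diagram

variable (G : Diagram)

/-- Contexts of a variable: joint values of its parents. -/
abbrev Ctx (v : Fin G.numVars) : Type :=
  (p : Fin (G.parents v).length) → Fin (G.dom ((G.parents v).get p))

/-- Outcomes: joint values of all variables. -/
abbrev Outcome : Type := (v : Fin G.numVars) → Fin (G.dom v)

/-- The context of a variable in an outcome. -/
def ctx {G : Diagram} (ω : G.Outcome) (v : Fin G.numVars) : G.Ctx v :=
  fun p => ω ((G.parents v).get p)

/-- Decision rules of a variable: conditional distributions given the context. -/
abbrev Rule (v : Fin G.numVars) : Type := G.Ctx v → stdSimplex ℝ (Fin (G.dom v))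

/-- Conditional distributions given the context, with rational probabilities. -/
abbrev RatRule (v : Fin G.numVars) : Type := G.Ctx v → RatDist (G.dom v)

/-- The list of the values of a function on all contexts of `v` (in mixed radix order). -/
def encTable {G : Diagram} {v : Fin G.numVars} {α : Type} (enc : α → Data) (f : G.Ctx v → α) :
    Data :=
  .ofList (List.ofFn fun r => enc (f (finPiFinEquiv.symm r)))

/-- Types of variables, with the parameters of chance and utility variables. The conditional
distribution of a utility variable is deterministic; `value` lists the elements of its domain. -/
inductive Node (v : Fin G.numVars) : Type
  | chance (cpd : G.RatRule v) : Node v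
  | decision (agent : Fin G.numAgents) : Node v
  | utility (agent : Fin G.numAgents) (value : Fin (G.dom v) → Frac)
      (out : G.Ctx v → Fin (G.dom v)) : Node v

/-- The type of a variable, and the complete table of its parameters. -/
def Node.enc {G : Diagram} {v : Fin G.numVars} : G.Node v → Data
  | .chance c => .ofList [.unary 0, encTable RatDist.enc c]
  | .decision j => .ofList [.unary 1, .unary j]
  | .utility j value out =>
      .ofList [.unary 2, .unary j, .ofList (List.ofFn fun u => (value u).enc),
        encTable (fun u : Fin (G.dom v) => .unary u) out]

end Diagram

/-- Multi-agent influence diagrams with rational parameters. -/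
structure MAID : Type extends Diagram where
  node : (v : Fin numVars) → toDiagram.Node v

namespace MAID

variable (M : MAID)

/-- Behavioural policies of agent `j`: a decision rule for each of the decisions of `j`. -/
abbrev Policy (j : Fin M.numAgents) : Type :=
  (v : Fin M.numVars) → M.node v = .decision j → M.Rule v

/-- Partial policy profiles: a policy for each agent other than `i`. -/
abbrev PartialProfile (i : Fin M.numAgents) : Type :=
  (j : Fin M.numAgents) → j ≠ i → M.Policy j

/-- Full policy profiles: a policy for each agent. -/
abbrev Profile : Type := (j : Fin M.numAgents) → M.Policy j

/-- Behavioural policies with rational probabilities. -/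
abbrev RatPolicy (j : Fin M.numAgents) : Type :=
  (v : Fin M.numVars) → M.node v = .decision j → M.RatRule v

/-- Partial policy profiles with rational probabilities. -/
abbrev RatPartialProfile (i : Fin M.numAgents) : Type :=
  (j : Fin M.numAgents) → j ≠ i → M.RatPolicy j

variable {M}

/-- A rational policy as a policy. -/
noncomputable def RatPolicy.toReal {j : Fin M.numAgents} (π : M.RatPolicy j) : M.Policy j :=
  fun v h c => (π v h c).toReal

/-- A rational partial profile as a partial profile. -/
noncomputable def RatPartialProfile.toReal {i : Fin M.numAgents} (π : M.RatPartialProfile i) :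
    M.PartialProfile i :=
  fun j hj v h c => (π j hj v h c).toReal

/-- The full profile in which `i` uses `πi` and the other agents use `π`. -/
def join {i : Fin M.numAgents} (πi : M.Policy i) (π : M.PartialProfile i) : M.Profile :=
  fun j v h => if hj : j = i then πi v (hj ▸ h) else π j hj v h

/-- The conditional probability, under a profile, of the value of `v` in the outcome `ω` given the
values of the parents of `v` in `ω`. -/
noncomputable def condProb (π : M.Profile) (ω : M.Outcome) (v : Fin M.numVars) : ℝ :=
  match h : M.node v with
  | .chance cpd => ((cpd (Diagram.ctx ω v)).prob (ω v)).toReal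
  | .decision j => (π j v h (Diagram.ctx ω v)).1 (ω v)
  | .utility _ _ out => if ω v = out (Diagram.ctx ω v) then 1 else 0

/-- The joint distribution of all variables that is induced by a profile. -/
noncomputable def jointProb (π : M.Profile) (ω : M.Outcome) : ℝ :=
  ∏ v : Fin M.numVars, condProb π ω v

/-- The marginal probability that the variable `v` takes the value `x`. -/
noncomputable def marginal (π : M.Profile) (v : Fin M.numVars) (x : Fin (M.dom v)) : ℝ :=
  ∑ ω : M.Outcome with ω v = x, jointProb π ω

/-- The contribution of the variable `v` to the expected utility of agent `i`: its expected value
if `v` is a utility variable of `i`, and zero otherwise. -/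
noncomputable def varUtility (π : M.Profile) (i : Fin M.numAgents) (v : Fin M.numVars) : ℝ :=
  match M.node v with
  | .utility j value _ =>
      if j = i then ∑ u : Fin (M.dom v), marginal π v u * (value u).toReal else 0
  | _ => 0

/-- The expected utility of agent `i` under a profile. -/
noncomputable def expectedUtility (π : M.Profile) (i : Fin M.numAgents) : ℝ :=
  ∑ v : Fin M.numVars, varUtility π i v

/-- `πi` is a best response of agent `i` to the partial profile `π`. -/
def IsBestResponse {i : Fin M.numAgents} (πi : M.Policy i) (π : M.PartialProfile i) : Prop :=
  ∀ ϖ : M.Policy i, expectedUtility (join ϖ π) i ≤ expectedUtility (join πi π) i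

variable (M)

/-- The complete description of a MAID: the agents, and for each variable its domain, its parents,
its type and its parameters. The sets of agents, variables and values are written out (unary
notation), the numerical parameters are in binary notation. -/
def enc : Data :=
  .cons (.unary M.numAgents) (.ofList (List.ofFn fun v =>
    .ofList [.unary (M.dom v), .ofList ((M.parents v).map fun u => .unary u), (M.node v).enc]))

variable {M}

open Classical in
/-- The list over all variables with the table of the decision rule for each decision of `j`, and
`nil` for the other variables. -/
noncomputable def RatPolicy.enc {j : Fin M.numAgents} (π : M.RatPolicy j) : Data :=
  .ofList (List.ofFn fun v =>
    if h : M.node v = .decision j then Diagram.encTable RatDist.enc (π v h) else .nil)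

open Classical in
/-- The list over all agents with the policy of each agent other than `i`, and `nil` for `i`. -/
noncomputable def RatPartialProfile.enc {i : Fin M.numAgents} (π : M.RatPartialProfile i) : Data :=
  .ofList (List.ofFn fun j => if hj : j = i then .nil else RatPolicy.enc (π j hj))

variable (M)

/-- The in-degrees of the decisions of agent `i` are at most `k`, and these decisions and their
parents have at most `b` values each. -/
def BoundedDecisions (i : Fin M.numAgents) (k b : ℕ) : Prop :=
  ∀ v : Fin M.numVars, M.node v = .decision i →
    (M.parents v).length ≤ k ∧ M.dom v ≤ b ∧ ∀ u ∈ M.parents v, M.dom u ≤ b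

/-- The MAID in which the variable `v` has become a chance variable whose value is the function `f`
of its parents. -/
def fix (v : Fin M.numVars) (f : M.Ctx v → Fin (M.dom v)) : MAID :=
  { M with node := Function.update M.node v (.chance fun c => RatDist.pure (f c)) }

end MAID

/-- A class of MAIDs with a distinguished agent is closed under fixing decisions if replacing a
decision of that agent by a chance variable that follows a pure decision rule does not lead out of
the class. The class of all MAIDs is closed in this sense, and so is every class that is described
by properties of the graph, such as bounded treewidth, or by bounds on the number of decisions. -/
def ClosedUnderFixing (𝒞 : (M : MAID) → Fin M.numAgents → Prop) : Prop :=
  ∀ (M : MAID) (i : Fin M.numAgents) (v : Fin M.numVars) (f : M.Ctx v → Fin (M.dom v)),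
    𝒞 M i → M.node v = .decision i → 𝒞 (M.fix v f) i

/-! ## The two computational problems -/

/-- Instances of the search problem: a MAID, an agent, and a policy for each other agent. -/
structure BestResponseInput : Type where
  M : MAID
  i : Fin M.numAgents
  π : M.RatPartialProfile i

/-- The encoding of the instances of the search problem. -/
noncomputable def BestResponseInput.enc (x : BestResponseInput) : Data :=
  .ofList [x.M.enc, .unary x.i, MAID.RatPartialProfile.enc x.π]

/-- Instances of the decision problem Is-Best-Response: in addition, a rational number. -/
structure IsBestResponseInput : Type extends BestResponseInput where
  q : Frac

/-- The encoding of the instances of Is-Best-Response. -/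
noncomputable def IsBestResponseInput.enc (x : IsBestResponseInput) : Data :=
  .cons x.q.enc x.toBestResponseInput.enc

/-- The question of Is-Best-Response: does agent `i` have a policy whose expected utility against
the given partial profile exceeds `q`? -/
def IsBestResponseInput.question (x : IsBestResponseInput) : Prop :=
  ∃ πi : x.M.Policy x.i,
    x.q.toReal < MAID.expectedUtility (MAID.join πi (MAID.RatPartialProfile.toReal x.π)) x.i

/-! ## Facts about runs -/

/-! The expected utility is linear in the decision rule of each single variable
(`exists_expectedUtility_update_eq`), so rules can be made pure one after another without loss
(`exists_purePolicy_le`), and the optimum is attained by one of finitely many pure policies. If n is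
the size of the instance, the values of pure policies are integer multiples of 1 / D for a common D
≤ 2 ^ (2n) (`exists_hasDenom_value`), and all values are below 2 ^ (2n) in absolute value
(`abs_value_lt`).

Is-Best-Response compares the optimum with any given fraction. With L = 2n, bisection in 2L rounds
yields q with q < optimum ≤ q + 2 ^ (-L) (`searchBound_spec`). A pure policy whose value exceeds q
is less than 1 / D away from the optimum, hence optimal (`isBestResponse_of_lt`).

Such a policy is found by self-reduction, with q held fixed. Each decision of the agent in turn
becomes a chance variable that follows the first pure rule for which the optimum stays above q. Such
a rule exists because rules can be made pure (`question_fixBelow_succ`, `question_greedy`), and the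
queried instances stay in the class (`closed_fixBelow`, `boundedDecisions_fixBelow`). The number of
candidates per decision is bounded in terms of k and b, and they are listed by table lookup
(`polyTimeFun_pureRuleList`). Once all decisions are fixed, the chosen rules form a pure policy with
value above q (`lt_value_greedy`).

For the running time, `PolyTimeFun` is closed under composition, pairing, case distinction and loops
with polynomially many rounds and polynomially bounded states (`iterate`, `fold`). The bisection
needs no arithmetic beyond prepending bits, since numbers are written least significant bit first.
-/

theorem Runs.size_le {p : Cmd} {s s' : Store} {t : ℕ} (h : Runs p s s' t) (r : ℕ) :
    (s' r).size ≤ (s r).size + t := by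
  induction h with
  | setNil s x => by_cases hr : r = x <;> simp [hr]; omega
  | copy s x y => by_cases hr : r = x <;> simp [hr]; omega
  | cons s x y z => by_cases hr : r = x <;> simp [hr]; omega
  | head s x y => by_cases hr : r = x <;> simp [hr]; omega
  | tail s x y => by_cases hr : r = x <;> simp [hr]; omega
  | seq _ _ h₁ h₂ => omega
  | iteTrue _ _ h => omega
  | iteFalse _ _ h => omega
  | loopDone => omega
  | loopStep _ _ _ h₁ h₂ => omega

/-- A bound on the registers that occur in a program. -/
def Cmd.width : Cmd → ℕ
  | setNil x => x + 1
  | copy x y => max x y + 1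
  | cons x y z => max x (max y z) + 1
  | head x y => max x y + 1
  | tail x y => max x y + 1
  | seq p q => max p.width q.width
  | ite x p q => max (x + 1) (max p.width q.width)
  | loop x p => max (x + 1) p.width

/-- The registers that do not occur in a program do not matter. -/
theorem Runs.frame {p : Cmd} {s s' : Store} {t : ℕ} (h : Runs p s s' t) {m : ℕ}
    (hm : p.width ≤ m) {S : Store} (hS : ∀ r < m, S r = s r) :
    ∃ S', Runs p S S' t ∧ (∀ r < m, S' r = s' r) ∧ ∀ r, m ≤ r → S' r = S r := by
  have upd : ∀ {s S : Store} (x : ℕ) (d : Data), x < m → (∀ r < m, S r = s r) →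
      (∀ r < m, Function.update S x d r = Function.update s x d r) ∧
        ∀ r, m ≤ r → Function.update S x d r = S r := by
    intro s S x d hx hS
    refine ⟨fun r hr => ?_, fun r hr => ?_⟩
    · by_cases h : r = x <;> simp [h, hS r hr]
    · have : r ≠ x := by omega
      simp [this]
  induction h generalizing S with
  | setNil s x =>
    simp only [Cmd.width] at hm
    exact ⟨_, .setNil S x, upd x _ (by omega) hS⟩
  | copy s x y =>
    simp only [Cmd.width] at hm
    rw [← hS y (by omega)]
    exact ⟨_, .copy S x y, upd x _ (by omega) hS⟩
  | cons s x y z =>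
    simp only [Cmd.width] at hm
    rw [← hS y (by omega), ← hS z (by omega)]
    exact ⟨_, .cons S x y z, upd x _ (by omega) hS⟩
  | head s x y =>
    simp only [Cmd.width] at hm
    rw [← hS y (by omega)]
    exact ⟨_, .head S x y, upd x _ (by omega) hS⟩
  | tail s x y =>
    simp only [Cmd.width] at hm
    rw [← hS y (by omega)]
    exact ⟨_, .tail S x y, upd x _ (by omega) hS⟩
  | seq _ _ h₁ h₂ =>
    simp only [Cmd.width] at hm
    obtain ⟨S₁, r₁, e₁, f₁⟩ := h₁ (by omega) hS
    obtain ⟨S₂, r₂, e₂, f₂⟩ := h₂ (by omega) e₁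
    exact ⟨S₂, .seq r₁ r₂, e₂, fun r hr => (f₂ r hr).trans (f₁ r hr)⟩
  | @iteTrue x p q s s' t hx _ h =>
    simp only [Cmd.width] at hm
    obtain ⟨S₁, r₁, e₁, f₁⟩ := h (by omega) hS
    exact ⟨S₁, .iteTrue (by rwa [hS x (by omega)]) r₁, e₁, f₁⟩
  | @iteFalse x p q s s' t hx _ h =>
    simp only [Cmd.width] at hm
    obtain ⟨S₁, r₁, e₁, f₁⟩ := h (by omega) hS
    exact ⟨S₁, .iteFalse (by rwa [hS x (by omega)]) r₁, e₁, f₁⟩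
  | @loopDone x p s hx =>
    simp only [Cmd.width] at hm
    exact ⟨S, .loopDone (by rwa [hS x (by omega)]), hS, fun _ _ => rfl⟩
  | @loopStep x p s s' s'' t t' hx _ _ h₁ h₂ =>
    obtain ⟨S₁, r₁, e₁, f₁⟩ := h₁ (by simp only [Cmd.width] at hm; omega) hS
    obtain ⟨S₂, r₂, e₂, f₂⟩ := h₂ hm e₁
    simp only [Cmd.width] at hm
    exact ⟨S₂, .loopStep (by rwa [hS x (by omega)]) r₁ r₂, e₂,
      fun r hr => (f₂ r hr).trans (f₁ r hr)⟩

/-- Empties the registers `1, …, n + 1`. -/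
def Cmd.clear : ℕ → Cmd
  | 0 => .setNil 1
  | n + 1 => .seq (clear n) (.setNil (n + 2))

theorem Cmd.runs_clear (n : ℕ) (S : Store) :
    ∃ S', Runs (Cmd.clear n) S S' (2 * (n + 1)) ∧ S' 0 = S 0 ∧
      (∀ r, 1 ≤ r → r ≤ n + 1 → S' r = .nil) ∧ ∀ r, n + 2 ≤ r → S' r = S r := by
  induction n with
  | zero =>
    refine ⟨_, .setNil S 1, by simp, fun r h₁ h₂ => ?_, fun r hr => ?_⟩
    · obtain rfl : r = 1 := by omega
      simp
    · have : r ≠ 1 := by omega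
      simp [this]
  | succ n ih =>
    obtain ⟨S', h₁, h₂, h₃, h₄⟩ := ih
    refine ⟨_, .seq h₁ (.setNil S' (n + 2)), by simp [h₂], fun r hr₁ hr₂ => ?_, fun r hr => ?_⟩
    · by_cases hr : r = n + 2
      · simp [hr]
      · simp [hr, h₃ r hr₁ (by omega)]
    · have : r ≠ n + 2 := by omega
      simp [this, h₄ r (by omega)]

/-! ## Polynomially bounded functions -/

theorem Polynomial.eval_nat_mono (P : Polynomial ℕ) {m n : ℕ} (h : m ≤ n) :
    P.eval m ≤ P.eval n := by
  rw [Polynomial.eval_eq_sum, Polynomial.eval_eq_sum]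
  exact Finset.sum_le_sum fun i _ => Nat.mul_le_mul_left _ (Nat.pow_le_pow_left h i)

/-- `f` is bounded by a polynomial in the size of `i`. -/
def PolyBdd {α : Type} (i : α → Data) (f : α → ℕ) : Prop :=
  ∃ P : Polynomial ℕ, ∀ a, f a ≤ P.eval (i a).size

namespace PolyBdd

variable {α β : Type} {i j : α → Data} {f g : α → ℕ}

theorem of_le (hg : PolyBdd i g) (h : ∀ a, f a ≤ g a) : PolyBdd i f :=
  let ⟨P, hP⟩ := hg
  ⟨P, fun a => (h a).trans (hP a)⟩

theorem const (n : ℕ) : PolyBdd i fun _ => n :=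
  ⟨Polynomial.C n, fun a => by simp⟩

theorem add (hf : PolyBdd i f) (hg : PolyBdd i g) : PolyBdd i fun a => f a + g a :=
  let ⟨P, hP⟩ := hf
  let ⟨Q, hQ⟩ := hg
  ⟨P + Q, fun a => by simpa using Nat.add_le_add (hP a) (hQ a)⟩

theorem mul (hf : PolyBdd i f) (hg : PolyBdd i g) : PolyBdd i fun a => f a * g a :=
  let ⟨P, hP⟩ := hf
  let ⟨Q, hQ⟩ := hg
  ⟨P * Q, fun a => by simpa using Nat.mul_le_mul (hP a) (hQ a)⟩

theorem trans (hi : PolyBdd i fun a => (j a).size) (hf : PolyBdd j f) : PolyBdd i f :=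
  let ⟨P, hP⟩ := hi
  let ⟨Q, hQ⟩ := hf
  ⟨Q.comp P, fun a => by
    simpa using (hQ a).trans (Q.eval_nat_mono (hP a))⟩

theorem precomp (hf : PolyBdd i f) (φ : β → α) : PolyBdd (fun b => i (φ b)) fun b => f (φ b) :=
  let ⟨P, hP⟩ := hf
  ⟨P, fun b => hP (φ b)⟩

end PolyBdd

/-! ## Functions computable in polynomial time -/

/-- Some program replaces the content `i a` of register `0` by `o a` in polynomial time, whatever
the other registers contain. -/
def PolyTimeFun {α : Type} (i o : α → Data) : Prop :=
  ∃ (p : Cmd) (m : ℕ) (P : Polynomial ℕ), ∀ (a : α) (S : Store), S 0 = i a →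
    ∃ (S' : Store) (t : ℕ), Runs p S S' t ∧ S' 0 = o a ∧ (∀ r, m ≤ r → S' r = S r) ∧
      t ≤ P.eval (i a).size

namespace PolyTimeFun

variable {α β : Type} {i j o o₁ o₂ c : α → Data}

theorem computes (h : PolyTimeFun i o) : ∃ (p : Cmd) (P : Polynomial ℕ),
    ∀ a, Computes p (i a) (o a) (P.eval (i a).size) := by
  obtain ⟨p, m, P, h⟩ := h
  refine ⟨p, P, fun a => ?_⟩
  obtain ⟨S', t, h₁, h₂, -, h₃⟩ := h a (initStore (i a)) (by simp [initStore])
  exact ⟨S', t, h₁, h₂, h₃⟩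

/-- `Computes` assumes that all registers but the first are empty. Emptying the registers that the
program can see makes it a subroutine that works in any memory. -/
theorem of_computes {p : Cmd} {P : Polynomial ℕ}
    (h : ∀ a, Computes p (i a) (o a) (P.eval (i a).size)) : PolyTimeFun i o := by
  refine ⟨.seq (.clear p.width) p, p.width + 2, P + Polynomial.C (2 * (p.width + 1)),
    fun a S hS => ?_⟩
  obtain ⟨S₁, h₁, h₂, h₃, h₄⟩ := Cmd.runs_clear p.width S
  obtain ⟨s, t, h₅, h₆, h₇⟩ := h a
  obtain ⟨S₂, h₈, h₉, h₁₀⟩ := h₅.frame (m := p.width + 2) (by omega) (S := S₁) (by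
    intro r hr
    by_cases h0 : r = 0
    · simp [h0, initStore, h₂, hS]
    · simp [initStore, h0, h₃ r (by omega) (by omega)])
  refine ⟨S₂, _, .seq h₁ h₈, by rw [h₉ 0 (by omega), h₆],
    fun r hr => (h₁₀ r hr).trans (h₄ r hr), ?_⟩
  simp only [Polynomial.eval_add, Polynomial.eval_C]
  omega

theorem precomp (h : PolyTimeFun i o) (φ : β → α) :
    PolyTimeFun (fun b => i (φ b)) fun b => o (φ b) :=
  let ⟨p, m, P, h⟩ := h
  ⟨p, m, P, fun b => h (φ b)⟩

/-- Writing a tree is charged by its size, so the output is no larger than the input plus the time.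
-/
theorem polyBdd (h : PolyTimeFun i o) : PolyBdd i fun a => (o a).size := by
  obtain ⟨p, m, P, h⟩ := h
  refine ⟨P + Polynomial.X, fun a => ?_⟩
  obtain ⟨S', t, h₁, h₂, -, h₃⟩ := h a (initStore (i a)) (by simp [initStore])
  have := h₁.size_le 0
  simp only [h₂, initStore, Function.update_self] at this
  simp only [Polynomial.eval_add, Polynomial.eval_X]
  omega

theorem id : PolyTimeFun i i :=
  -- There is no instruction that does nothing; emptying a scratch register takes its place.
  ⟨.setNil 1, 2, 2, fun a S hS => ⟨_, _, .setNil S 1, by simpa using hS, fun r hr => by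
    have : r ≠ 1 := by omega
    simp [this], by simp [Data.size]⟩⟩

theorem comp (h₁ : PolyTimeFun i j) (h₂ : PolyTimeFun j o) : PolyTimeFun i o := by
  obtain ⟨R, hR⟩ := h₁.polyBdd
  obtain ⟨p, m, P, h₁⟩ := h₁
  obtain ⟨q, n, Q, h₂⟩ := h₂
  refine ⟨.seq p q, max m n, P + Q.comp R, fun a S hS => ?_⟩
  obtain ⟨S₁, t₁, r₁, e₁, f₁, b₁⟩ := h₁ a S hS
  obtain ⟨S₂, t₂, r₂, e₂, f₂, b₂⟩ := h₂ a S₁ e₁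
  refine ⟨S₂, _, .seq r₁ r₂, e₂, fun r hr => ?_, ?_⟩
  · rw [f₂ r (by omega), f₁ r (by omega)]
  · have : Q.eval (j a).size ≤ _ := Q.eval_nat_mono (hR a)
    simp only [Polynomial.eval_add, Polynomial.eval_comp]
    omega

theorem nil : PolyTimeFun i fun _ => .nil :=
  ⟨.setNil 0, 1, 2, fun a S hS => ⟨_, _, .setNil S 0, by simp, fun r hr => by
    have : r ≠ 0 := by omega
    simp [this], by simp [Data.size]⟩⟩

theorem head (h : PolyTimeFun i o) : PolyTimeFun i fun a => (o a).head := by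
  refine h.comp ⟨.head 0 0, 1, Polynomial.X + 1, fun a S hS => ⟨_, _, .head S 0 0, by simp [hS],
    fun r hr => ?_, ?_⟩⟩
  · have : r ≠ 0 := by omega
    simp [this]
  · rw [hS]
    cases o a <;> simp [Data.head, Data.size]
    omega

theorem tail (h : PolyTimeFun i o) : PolyTimeFun i fun a => (o a).tail := by
  refine h.comp ⟨.tail 0 0, 1, Polynomial.X + 1, fun a S hS => ⟨_, _, .tail S 0 0, by simp [hS],
    fun r hr => ?_, ?_⟩⟩
  · have : r ≠ 0 := by omega
    simp [this]
  · rw [hS]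
    cases o a <;> simp [Data.tail, Data.size]
    omega

theorem fst (h : PolyTimeFun i fun a => .cons (o₁ a) (o₂ a)) : PolyTimeFun i o₁ := h.head

theorem snd (h : PolyTimeFun i fun a => .cons (o₁ a) (o₂ a)) : PolyTimeFun i o₂ := h.tail

/-- Register `M` lies above all registers that the two subprograms may change. It keeps the input
for the second one, while register `M + 1` keeps the first result. -/
theorem cons (h₁ : PolyTimeFun i o₁) (h₂ : PolyTimeFun i o₂) :
    PolyTimeFun i fun a => .cons (o₁ a) (o₂ a) := by
  obtain ⟨R₁, hR₁⟩ := h₁.polyBdd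
  obtain ⟨R₂, hR₂⟩ := h₂.polyBdd
  obtain ⟨p, m, P, h₁⟩ := h₁
  obtain ⟨q, n, Q, h₂⟩ := h₂
  obtain ⟨M, hM⟩ : ∃ M, M = max m n + 1 := ⟨_, rfl⟩
  refine ⟨.seq (.copy M 0) (.seq p (.seq (.copy (M + 1) 0) (.seq (.copy 0 M)
      (.seq q (.cons 0 (M + 1) 0))))), M + 2,
    P + Q + 2 * R₁ + R₂ + 2 * Polynomial.X + 6, fun a S hS => ?_⟩
  obtain ⟨S₁, t₁, r₁, e₁, f₁, b₁⟩ := h₁ a (Function.update S M (S 0))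
    (by rw [Function.update_of_ne (by omega), hS])
  obtain ⟨S₂, t₂, r₂, e₂, f₂, b₂⟩ := h₂ a
    (Function.update (Function.update S₁ (M + 1) (S₁ 0)) 0
      (Function.update S₁ (M + 1) (S₁ 0) M))
    (by rw [Function.update_self, Function.update_of_ne (by omega), f₁ M (by omega),
          Function.update_self, hS])
  have hM1 : S₂ (M + 1) = o₁ a := by
    rw [f₂ _ (by omega), Function.update_of_ne (by omega), Function.update_self, e₁]
  refine ⟨_, _, .seq (.copy _ _ _) (.seq r₁ (.seq (.copy _ _ _) (.seq (.copy _ _ _)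
    (.seq r₂ (.cons _ _ _ _))))), ?_, fun r hr => ?_, ?_⟩
  · simp [hM1, e₂]
  · rw [Function.update_of_ne (by omega), f₂ r (by omega), Function.update_of_ne (by omega),
      Function.update_of_ne (by omega), f₁ r (by omega), Function.update_of_ne (by omega)]
  · have e₃ : Function.update S₁ (M + 1) (S₁ 0) M = i a := by
      rw [Function.update_of_ne (by omega), f₁ M (by omega), Function.update_self, hS]
    have : (o₁ a).size ≤ _ := hR₁ a
    have : (o₂ a).size ≤ _ := hR₂ a
    rw [e₃, hM1, e₂, hS, e₁]
    simp only [Data.size, Polynomial.eval_add, Polynomial.eval_mul, Polynomial.eval_X,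
      Polynomial.eval_ofNat]
    omega

theorem const (d : Data) : PolyTimeFun i fun _ => d := by
  induction d with
  | nil => exact nil
  | cons l r hl hr => exact hl.cons hr

/-- Each branch runs only on inputs that pass its test, so it need only be computable on the
corresponding subtype. This lets a subroutine with preconditions be called after they have been
tested. -/
theorem cases (hc : PolyTimeFun i c)
    (h₁ : PolyTimeFun (fun a : {a // c a ≠ .nil} => i a.1) fun a => o a.1)
    (h₂ : PolyTimeFun (fun a : {a // c a = .nil} => i a.1) fun a => o a.1) :
    PolyTimeFun i o := by
  obtain ⟨R, hR⟩ := hc.polyBdd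
  obtain ⟨pc, l, C, hc⟩ := hc
  obtain ⟨p, m, P, h₁⟩ := h₁
  obtain ⟨q, n, Q, h₂⟩ := h₂
  obtain ⟨M, hM⟩ : ∃ M, M = max l (max m n) + 1 := ⟨_, rfl⟩
  refine ⟨.seq (.copy M 0) (.seq pc (.seq (.copy (M + 1) 0) (.seq (.copy 0 M)
      (.ite (M + 1) p q)))), M + 2,
    C + P + Q + R + 2 * Polynomial.X + 4, fun a S hS => ?_⟩
  obtain ⟨S₁, t₁, r₁, e₁, f₁, b₁⟩ := hc a (Function.update S M (S 0))
    (by rw [Function.update_of_ne (by omega), hS])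
  obtain ⟨S₂, hS₂⟩ : ∃ S₂, S₂ = Function.update (Function.update S₁ (M + 1) (S₁ 0)) 0
      (Function.update S₁ (M + 1) (S₁ 0) M) := ⟨_, rfl⟩
  have e₃ : Function.update S₁ (M + 1) (S₁ 0) M = i a := by
    rw [Function.update_of_ne (by omega), f₁ M (by omega), Function.update_self, hS]
  have hM1 : S₂ (M + 1) = c a := by
    rw [hS₂, Function.update_of_ne (by omega), Function.update_self, e₁]
  have h0 : S₂ 0 = i a := by
    rw [hS₂, Function.update_self, e₃]
  have hf : ∀ r, M + 2 ≤ r → S₂ r = S r := fun r hr => by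
    rw [hS₂, Function.update_of_ne (by omega),
      Function.update_of_ne (by omega), f₁ r (by omega), Function.update_of_ne (by omega)]
  have hRa : (c a).size ≤ _ := hR a
  obtain ⟨S₃, t₃, r₃, e₄, f₃, b₃⟩ : ∃ S₃ t₃, Runs (.ite (M + 1) p q) S₂ S₃ t₃ ∧ S₃ 0 = o a ∧
      (∀ r, M + 2 ≤ r → S₃ r = S₂ r) ∧ t₃ ≤ 1 + P.eval (i a).size + Q.eval (i a).size := by
    by_cases hca : c a = .nil
    · obtain ⟨S₃, t₃, r₃, e₄, f₃, b₃⟩ := h₂ ⟨a, hca⟩ S₂ h0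
      exact ⟨S₃, _, .iteFalse (by rw [hM1, hca]) r₃, e₄, fun r hr => f₃ r (by omega), by
        simp only at b₃
        omega⟩
    · obtain ⟨S₃, t₃, r₃, e₄, f₃, b₃⟩ := h₁ ⟨a, hca⟩ S₂ h0
      exact ⟨S₃, _, .iteTrue (by rwa [hM1]) r₃, e₄, fun r hr => f₃ r (by omega), by
        simp only at b₃
        omega⟩
  refine ⟨S₃, _, .seq (.copy _ _ _) (.seq r₁ (.seq (.copy _ _ _) (.seq (.copy _ _ _)
    (hS₂ ▸ r₃)))), e₄, fun r hr => (f₃ r hr).trans (hf r hr), ?_⟩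
  rw [e₃, hS, e₁]
  simp only [Polynomial.eval_add, Polynomial.eval_mul, Polynomial.eval_X,
      Polynomial.eval_ofNat]
  omega

open Classical in
theorem ite (hc : PolyTimeFun i c) (h₁ : PolyTimeFun i o₁) (h₂ : PolyTimeFun i o₂) :
    PolyTimeFun i fun a => if c a = .nil then o₂ a else o₁ a := by
  refine cases hc ?_ ?_
  · convert h₁.precomp (fun a : {a // c a ≠ .nil} => a.1) using 2 with a
    simp [a.2]
  · convert h₂.precomp (fun a : {a // c a = .nil} => a.1) using 2 with a
    simp [a.2]

/-- A loop: `s a n` is the state after `n` rounds. -/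
theorem iterate {s : α → ℕ → Data} {N : α → ℕ} (h₀ : PolyTimeFun i fun a => s a 0)
    (hN : PolyBdd i N)
    (hs : PolyBdd (fun b : {b : α × ℕ // b.2 ≤ N b.1} => i b.1.1) fun b => (s b.1.1 b.1.2).size)
    (hlt : ∀ a, ∀ n < N a, (s a n).head ≠ .nil) (hend : ∀ a, (s a (N a)).head = .nil)
    (hstep : PolyTimeFun (fun b : {b : α × ℕ // b.2 < N b.1} => s b.1.1 b.1.2)
      fun b => s b.1.1 (b.1.2 + 1)) :
    PolyTimeFun i fun a => s a (N a) := by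
  obtain ⟨p, l, P, h₀⟩ := h₀
  obtain ⟨q, m, Q, hq⟩ := hstep
  obtain ⟨K, hK⟩ := hN
  obtain ⟨B, hB⟩ := hs
  obtain ⟨M, hM⟩ : ∃ M, M = max l m + 1 := ⟨_, rfl⟩
  have hsz : ∀ d : Data, d.head.size ≤ d.size := by
    rintro (_ | ⟨l, r⟩) <;> simp [Data.head, Data.size]
    omega
  -- Induction on the number `k` of rounds that remain. The size of every state is bounded by `B` in
  -- terms of the original input, not of the preceding state, so the same polynomial bounds the cost
  -- of each round and the costs do not compound.
  have hloop : ∀ a k n, n + k = N a → ∀ S : Store, S 0 = s a n → S M = (s a n).head →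
      ∃ S' t, Runs (.loop M (.seq q (.head M 0))) S S' t ∧ S' 0 = s a (N a) ∧
        (∀ r, M + 1 ≤ r → S' r = S r) ∧
        t ≤ 1 + k * (2 + Q.eval (B.eval (i a).size) + B.eval (i a).size) := by
    intro a k
    induction k with
    | zero =>
      intro n hn S h0 h1
      obtain rfl : n = N a := by omega
      exact ⟨S, 1, .loopDone (by rw [h1, hend]), h0, fun _ _ => rfl, by omega⟩
    | succ k ih =>
      intro n hn S h0 h1
      obtain ⟨S₁, t₁, r₁, e₁, f₁, b₁⟩ := hq ⟨(a, n), by simp only; omega⟩ S h0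
      obtain ⟨S₂, t₂, r₂, e₂, f₂, b₂⟩ := ih (n + 1) (by omega)
        (Function.update S₁ M (S₁ 0).head) (by rw [Function.update_of_ne (by omega), e₁])
        (by rw [Function.update_self, e₁])
      refine ⟨S₂, _, .loopStep (by rw [h1]; exact hlt a n (by omega)) (.seq r₁ (.head _ _ _)) r₂,
        e₂, fun r hr => ?_, ?_⟩
      · rw [f₂ r hr, Function.update_of_ne (by omega), f₁ r (by omega)]
      · have h₁ := hB ⟨(a, n), by simp only; omega⟩
        have h₂ := hB ⟨(a, n + 1), by simp only; omega⟩
        have h₃ := Q.eval_nat_mono h₁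
        have h₄ := hsz (s a (n + 1))
        simp only at h₁ h₂ h₃ b₁ e₁
        rw [e₁, Nat.add_mul]
        omega
  refine ⟨.seq p (.seq (.head M 0) (.loop M (.seq q (.head M 0)))), M + 1,
    P + 2 + B + K * (2 + Q.comp B + B), fun a S hS => ?_⟩
  obtain ⟨S₁, t₁, r₁, e₁, f₁, b₁⟩ := h₀ a S hS
  obtain ⟨S₂, t₂, r₂, e₂, f₂, b₂⟩ := hloop a (N a) 0 (by omega)
    (Function.update S₁ M (S₁ 0).head) (by rw [Function.update_of_ne (by omega), e₁])
    (by rw [Function.update_self, e₁])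
  refine ⟨S₂, _, .seq r₁ (.seq (.head _ _ _) r₂), e₂, fun r hr => ?_, ?_⟩
  · rw [f₂ r hr, Function.update_of_ne (by omega), f₁ r (by omega)]
  · have h₁ := hB ⟨(a, 0), by simp⟩
    have h₂ := hsz (s a 0)
    have h₃ := Nat.mul_le_mul_right (2 + Q.eval (B.eval (i a).size) + B.eval (i a).size) (hK a)
    simp only [Polynomial.eval_add, Polynomial.eval_mul, Polynomial.eval_comp,
      Polynomial.eval_ofNat] at *
    rw [e₁]
    omega

end PolyTimeFun


/-! ### Sizes of encoded lists and numbers. -/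

namespace Data

theorem size_pos (d : Data) : 1 ≤ d.size := by cases d <;> simp [size]

theorem size_ofList (l : List Data) : (ofList l).size = (l.map fun d => d.size + 1).sum + 1 := by
  induction l with
  | nil => rfl
  | cons d l ih => simp only [ofList, size, ih, List.map_cons, List.sum_cons]; omega

theorem size_le_of_mem {l : List Data} {d : Data} (h : d ∈ l) : d.size < (ofList l).size := by
  rw [size_ofList]
  have := List.single_le_sum (l := l.map fun d => d.size + 1) (fun _ _ => Nat.zero_le _) (d.size + 1)
    (List.mem_map_of_mem h)
  omega

theorem size_ofList_append (l₁ l₂ : List Data) :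
    (ofList (l₁ ++ l₂)).size + 1 = (ofList l₁).size + (ofList l₂).size := by
  simp only [size_ofList, List.map_append, List.sum_append]
  omega

theorem size_ofList_reverse (l : List Data) : (ofList l.reverse).size = (ofList l).size := by
  simp [size_ofList, List.sum_reverse]

theorem size_ofList_take_le (l : List Data) (n : ℕ) :
    (ofList (l.take n)).size ≤ (ofList l).size := by
  have := size_ofList_append (l.take n) (l.drop n)
  have := size_pos (ofList (l.drop n))
  rw [List.take_append_drop] at *
  omega

theorem size_ofList_drop_le (l : List Data) (n : ℕ) :
    (ofList (l.drop n)).size ≤ (ofList l).size := by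
  have := size_ofList_append (l.take n) (l.drop n)
  have := size_pos (ofList (l.take n))
  rw [List.take_append_drop] at *
  omega

theorem length_lt_size_ofList (l : List Data) : l.length < (ofList l).size := by
  induction l with
  | nil => simp [ofList, size]
  | cons d l ih => simp only [ofList, size, List.length_cons]; omega

theorem size_ofList_le_of_forall {l : List Data} {B : ℕ} (h : ∀ d ∈ l, d.size ≤ B) :
    (ofList l).size ≤ l.length * (B + 1) + 1 := by
  induction l with
  | nil => simp [ofList, size]
  | cons d l ih =>
    have h₁ := h d (by simp)
    have h₂ := ih fun d hd => h d (by simp [hd])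
    simp only [ofList, size, List.length_cons, Nat.add_mul]
    omega

theorem ofList_injective : Function.Injective ofList := by
  intro l
  induction l with
  | nil => rintro (_ | ⟨d, l'⟩) h <;> simp_all [ofList]
  | cons d l ih =>
    rintro (_ | ⟨d', l'⟩) h
    · simp [ofList] at h
    · simp only [ofList, Data.cons.injEq] at h
      rw [h.1, ih h.2]

theorem ofList_eq_nil {l : List Data} : ofList l = .nil ↔ l = [] := by
  cases l <;> simp [ofList]

theorem size_unary (n : ℕ) : (unary n).size = 2 * n + 1 := by
  simp [unary, size_ofList, size]
  omega

theorem unary_injective : Function.Injective unary := by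
  intro m n h
  have := congrArg size h
  rw [size_unary, size_unary] at this
  omega

theorem unary_succ (n : ℕ) : unary (n + 1) = .cons .nil (unary n) := rfl

theorem binary_eq_nil {n : ℕ} : binary n = .nil ↔ n = 0 := by
  rw [binary, ofList_eq_nil, List.map_eq_nil_iff, ← List.length_eq_zero_iff, Nat.size_eq_bits_len,
    Nat.size_eq_zero]

theorem binary_two_mul_add_one (n : ℕ) :
    binary (2 * n + 1) = .cons (.cons .nil .nil) (binary n) := by
  simp [binary, Nat.bit1_bits, ofList, ofBool]

theorem binary_two_mul {n : ℕ} (hn : n ≠ 0) : binary (2 * n) = .cons .nil (binary n) := by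
  simp [binary, Nat.bit0_bits n hn, ofList, ofBool]

theorem binary_two_pow_mul {n : ℕ} (hn : n ≠ 0) (j : ℕ) :
    binary (2 ^ j * n) = ofList (List.replicate j .nil ++ n.bits.map ofBool) := by
  induction j with
  | zero => simp [binary]
  | succ j ih =>
    rw [show 2 ^ (j + 1) * n = 2 * (2 ^ j * n) by ring, binary_two_mul (by positivity), ih]
    rfl

theorem size_binary_le (n : ℕ) : (binary n).size ≤ 4 * n.size + 1 := by
  rw [binary, ← Nat.size_eq_bits_len, mul_comm, ← List.length_map (f := ofBool)]
  refine size_ofList_le_of_forall (B := 3) fun d hd => ?_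
  obtain ⟨b, -, rfl⟩ := List.mem_map.1 hd
  cases b <;> simp [ofBool, size]

theorem lt_two_pow_size_binary (n : ℕ) : n < 2 ^ (binary n).size := by
  refine (Nat.lt_size_self n).trans_le (Nat.pow_le_pow_right (by norm_num) ?_)
  rw [binary, ← Nat.size_eq_bits_len, ← List.length_map (f := ofBool)]
  exact (length_lt_size_ofList _).le

theorem finite_size_le (n : ℕ) : {d : Data | d.size ≤ n}.Finite := by
  induction n with
  | zero =>
    refine Set.finite_empty.subset fun d hd => ?_
    have := size_pos d
    simp only [Set.mem_ofPred_eq] at hd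
    omega
  | succ n ih =>
    refine ((Set.finite_singleton Data.nil).union (ih.image2 Data.cons ih)).subset ?_
    rintro (_ | ⟨l, r⟩) hd
    · simp
    · simp only [Set.mem_ofPred_eq, size] at hd
      exact Or.inr ⟨l, by simp only [Set.mem_ofPred_eq]; omega, r,
        by simp only [Set.mem_ofPred_eq]; omega, rfl⟩

end Data

/-! ## Decidable predicates -/

open Classical in
/-- Predicates that can be decided in polynomial time. -/
def PolyTimePred {α : Type} (i : α → Data) (p : α → Prop) : Prop :=
  PolyTimeFun i fun a => if p a then .cons .nil .nil else .nil

namespace PolyTimePred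

variable {α β : Type} {i j o o₁ o₂ : α → Data} {p q : α → Prop}

theorem congr (h : PolyTimePred i p) (hpq : ∀ a, p a ↔ q a) : PolyTimePred i q := by
  rwa [← funext fun a => propext (hpq a)]

theorem comp (h₁ : PolyTimeFun i j) (h₂ : PolyTimePred j p) : PolyTimePred i p :=
  PolyTimeFun.comp h₁ h₂

theorem precomp (h : PolyTimePred i p) (φ : β → α) :
    PolyTimePred (fun b => i (φ b)) fun b => p (φ b) :=
  PolyTimeFun.precomp h φ

open Classical in
theorem ite (h : PolyTimePred i p) (h₁ : PolyTimeFun i o₁) (h₂ : PolyTimeFun i o₂) :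
    PolyTimeFun i fun a => if p a then o₁ a else o₂ a := by
  convert PolyTimeFun.ite h h₁ h₂ using 2 with a
  by_cases hp : p a <;> simp [hp]

theorem cases (h : PolyTimePred i p)
    (h₁ : PolyTimeFun (fun a : {a // p a} => i a.1) fun a => o a.1)
    (h₂ : PolyTimeFun (fun a : {a // ¬ p a} => i a.1) fun a => o a.1) : PolyTimeFun i o := by
  refine PolyTimeFun.cases h ?_ ?_
  · exact h₁.precomp fun a : {a // _} => ⟨a.1, by have := a.2; simp at this; exact this⟩
  · exact h₂.precomp fun a : {a // _} => ⟨a.1, by have := a.2; simp at this; exact this⟩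

theorem isNil (h : PolyTimeFun i o) : PolyTimePred i fun a => o a = .nil := by
  unfold PolyTimePred
  convert PolyTimeFun.ite h (PolyTimeFun.const .nil) (PolyTimeFun.const (.cons .nil .nil))

theorem not (h : PolyTimePred i p) : PolyTimePred i fun a => ¬ p a :=
  (isNil h).congr fun a => by by_cases hp : p a <;> simp [hp]

theorem and (h₁ : PolyTimePred i p) (h₂ : PolyTimePred i q) :
    PolyTimePred i fun a => p a ∧ q a := by
  unfold PolyTimePred
  convert h₁.ite h₂ (PolyTimeFun.const .nil) using 2 with a
  by_cases hp : p a <;> by_cases hq : q a <;> simp [hp, hq]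

theorem iff (h₁ : PolyTimePred i p) (h₂ : PolyTimePred i q) :
    PolyTimePred i fun a => p a ↔ q a := by
  unfold PolyTimePred
  convert h₁.ite h₂ h₂.not using 2 with a
  by_cases hp : p a <;> by_cases hq : q a <;> simp [hp, hq]

theorem eq_const (h : PolyTimeFun i o) (d : Data) : PolyTimePred i fun a => o a = d := by
  induction d generalizing o with
  | nil => exact isNil h
  | cons l r hl hr =>
    refine ((isNil h).not.and ((hl h.head).and (hr h.tail))).congr fun a => ?_
    cases o a <;> simp [Data.head, Data.tail]

end PolyTimePred

/-! ## List operations in polynomial time -/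

namespace PolyTimeFun

variable {α β : Type} {i o e : α → Data} {l l₁ l₂ : α → List Data} {m n : α → ℕ}

theorem congr_fun {o' : α → Data} (h : PolyTimeFun i o) (ho : ∀ a, o a = o' a) :
    PolyTimeFun i o' := by
  rwa [← funext ho]

/-- A loop over a list: `acc a n` is the value of the accumulator after `n` entries. -/
theorem fold {acc : α → ℕ → Data} (hl : PolyTimeFun i fun a => .ofList (l a))
    (he : PolyTimeFun i e) (h₀ : PolyTimeFun i fun a => acc a 0)
    (hacc : PolyBdd (fun b : {b : α × ℕ // b.2 ≤ (l b.1).length} => i b.1.1)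
      fun b => (acc b.1.1 b.1.2).size)
    (hstep : ∀ j : {b : α × ℕ // b.2 < (l b.1).length} → Data,
      PolyTimeFun j (fun b => (l b.1.1)[b.1.2]'b.2) →
      PolyTimeFun j (fun b => .ofList ((l b.1.1).drop (b.1.2 + 1))) →
      PolyTimeFun j (fun b => e b.1.1) → PolyTimeFun j (fun b => acc b.1.1 b.1.2) →
        PolyTimeFun j fun b => acc b.1.1 (b.1.2 + 1)) :
    PolyTimeFun i fun a => acc a (l a).length := by
  -- The state consists of the unread part of the list, the constant environment and the
  -- accumulator; its head is `nil` exactly when the list is used up. Since `hstep` holds for every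
  -- encoding `j`, the body of a loop can be built from these components without reference to their
  -- layout.
  refine (iterate (s := fun a n => .cons (.ofList ((l a).drop n)) (.cons (e a) (acc a n)))
    (N := fun a => (l a).length) ?_ ?_ ?_ ?_ ?_ ?_).snd.snd
  · simpa using hl.cons (he.cons h₀)
  · exact hl.polyBdd.of_le fun a => (Data.length_lt_size_ofList _).le
  · refine ((((hl.polyBdd.precomp _).add ((he.polyBdd.precomp _).add hacc)).add
      (PolyBdd.const 2))).of_le fun b => ?_
    have := Data.size_ofList_drop_le (l b.1.1) b.1.2
    simp only [Data.size]
    omega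
  · intro a n hn
    simp only [Data.head, ne_eq, Data.ofList_eq_nil, List.drop_eq_nil_iff]
    omega
  · simp [Data.head, Data.ofList]
  · have hhead := (id (i := fun b : {b : α × ℕ // b.2 < (l b.1).length} =>
      Data.cons (.ofList ((l b.1.1).drop b.1.2)) (.cons (e b.1.1) (acc b.1.1 b.1.2)))).fst.head
    have htail := (id (i := fun b : {b : α × ℕ // b.2 < (l b.1).length} =>
      Data.cons (.ofList ((l b.1.1).drop b.1.2)) (.cons (e b.1.1) (acc b.1.1 b.1.2)))).fst.tail
    replace htail := htail.congr_fun (o' := fun b => .ofList ((l b.1.1).drop (b.1.2 + 1)))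
      fun b => by rw [List.drop_eq_getElem_cons b.2]; rfl
    replace hhead := hhead.congr_fun (o' := fun b => (l b.1.1)[b.1.2]'b.2)
      fun b => by rw [List.drop_eq_getElem_cons b.2]; rfl
    exact htail.cons (id.snd.fst.cons (hstep _ hhead htail id.snd.fst id.snd.snd))

/-- Moving entries one by one from the front of one list to the front of another reverses them.
Reversal, unary addition and multiplication by powers of two are instances. -/
theorem reverse_append (h₁ : PolyTimeFun i fun a => .ofList (l₁ a))
    (h₂ : PolyTimeFun i fun a => .ofList (l₂ a)) :
    PolyTimeFun i fun a => .ofList ((l₁ a).reverse ++ l₂ a) := by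
  refine (fold (acc := fun a n => .ofList (((l₁ a).take n).reverse ++ l₂ a)) (e := fun _ => .nil)
    h₁ nil (by simpa using h₂) ?_ ?_).congr_fun fun a => by simp
  · refine ((h₁.polyBdd.precomp _).add (h₂.polyBdd.precomp _)).of_le fun b => ?_
    have := Data.size_ofList_take_le (l₁ b.1.1) b.1.2
    have := Data.size_ofList_append ((l₁ b.1.1).take b.1.2).reverse (l₂ b.1.1)
    rw [Data.size_ofList_reverse] at this
    omega
  · refine fun j hhead _ _ hacc => (hhead.cons hacc).congr_fun fun b => ?_
    rw [← List.take_concat_get' _ _ b.2]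
    simp only [Data.ofList, List.reverse_append, List.reverse_singleton, List.nil_append,
      List.cons_append]

theorem reverse (h : PolyTimeFun i fun a => .ofList (l a)) :
    PolyTimeFun i fun a => .ofList (l a).reverse := by
  simpa using h.reverse_append (l₂ := fun _ => []) nil

theorem drop (h₁ : PolyTimeFun i fun a => .ofList (l a)) (h₂ : PolyTimeFun i fun a => .unary (n a)) :
    PolyTimeFun i fun a => .ofList ((l a).drop (n a)) := by
  -- The unary number is itself the list over which the loop runs. If it exceeds the length, the
  -- surplus rounds are harmless because the tail of `nil` is `nil`.
  refine (fold (l := fun a => List.replicate (n a) .nil)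
    (acc := fun a n => .ofList ((l a).drop n)) (e := fun _ => .nil)
    h₂ nil (by simpa using h₁) ?_ ?_).congr_fun fun a => by simp
  · exact (h₁.polyBdd.precomp _).of_le fun b => Data.size_ofList_drop_le _ _
  · refine fun j _ _ _ hacc => hacc.tail.congr_fun fun b => ?_
    rw [← List.drop_drop]
    cases (l b.1.1).drop b.1.2 <;> simp [Data.ofList, Data.tail]

theorem unary_add (h₁ : PolyTimeFun i fun a => .unary (m a))
    (h₂ : PolyTimeFun i fun a => .unary (n a)) : PolyTimeFun i fun a => .unary (m a + n a) :=
  (reverse_append (l₁ := fun a => List.replicate (m a) .nil)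
    (l₂ := fun a => List.replicate (n a) .nil) h₁ h₂).congr_fun fun a => by
      simp [Data.unary, ← List.replicate_append_replicate]

/-- The entries are subtrees of the list, so the values of `g` on them have polynomial size, and so
does the list of values. The function is needed only on actual entries; the environment `e` provides
its further arguments. -/
theorem map {g : α → Data → Data} (hl : PolyTimeFun i fun a => .ofList (l a))
    (he : PolyTimeFun i e)
    (hg : ∀ j : {b : α × Data // b.2 ∈ l b.1} → Data, PolyTimeFun j (fun b => b.1.2) →
      PolyTimeFun j (fun b => e b.1.1) → PolyTimeFun j fun b => g b.1.1 b.1.2) :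
    PolyTimeFun i fun a => .ofList ((l a).map (g a)) := by
  replace hg := hg (fun b => .cons b.1.2 (e b.1.1)) id.fst id.snd
  have hsize : PolyBdd (fun b : {b : α × Data // b.2 ∈ l b.1} => i b.1.1)
      fun b => (g b.1.1 b.1.2).size := by
    refine PolyBdd.trans ?_ hg.polyBdd
    refine (((hl.polyBdd.precomp _).add (he.polyBdd.precomp _)).add (PolyBdd.const 1)).of_le
      fun b => ?_
    have := Data.size_le_of_mem b.2
    simp only [Data.size]
    omega
  refine (fold (acc := fun a n => .ofList (((l a).take n).map (g a)).reverse) (e := e)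
    hl he (by simpa [Data.ofList] using nil) ?_ ?_).reverse.congr_fun fun a => by simp
  · obtain ⟨P, hP⟩ := hsize
    obtain ⟨Q, hQ⟩ := hl.polyBdd
    refine ⟨Q * (P + 1) + 1, fun b => ?_⟩
    simp only [Data.size_ofList_reverse]
    refine (Data.size_ofList_le_of_forall (B := P.eval (i b.1.1).size) fun d hd => ?_).trans ?_
    · obtain ⟨x, hx, rfl⟩ := List.mem_map.1 hd
      exact hP ⟨(b.1.1, x), List.mem_of_mem_take hx⟩
    · have := b.2
      have : (l b.1.1).length ≤ Q.eval (i b.1.1).size :=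
        (Data.length_lt_size_ofList _).le.trans (hQ b.1.1)
      simp only [Polynomial.eval_add, Polynomial.eval_mul, Polynomial.eval_one,
        List.length_map, List.length_take]
      gcongr
      omega
  · refine fun j hhead _ henv hacc => PolyTimeFun.cons
      (o₁ := fun b => g b.1.1 ((l b.1.1)[b.1.2]'b.2)) ?_ hacc |>.congr_fun fun b => ?_
    · exact PolyTimeFun.comp (hhead.cons henv)
        (hg.precomp fun b : {b : α × ℕ // b.2 < (l b.1).length} =>
          ⟨(b.1.1, (l b.1.1)[b.1.2]'b.2), List.getElem_mem _⟩)
    · rw [← List.take_concat_get' _ _ b.2]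
      simp only [Data.ofList, List.map_append, List.map_cons, List.map_nil, List.reverse_append,
        List.reverse_singleton, List.singleton_append]

/-- Depth first traversal of a list of trees, one node at a time. -/
def traverse : List Data → List Data
  | [] => []
  | .nil :: ds => ds
  | .cons l r :: ds => l :: r :: ds

theorem sum_size_traverse (l : List Data) :
    ((traverse l).map Data.size).sum = (l.map Data.size).sum - 1 := by
  rcases l with _ | ⟨_ | ⟨a, b⟩, l⟩ <;> simp [traverse, Data.size]
  omega

theorem sum_size_iterate_traverse (l : List Data) (n : ℕ) :
    ((traverse^[n] l).map Data.size).sum = (l.map Data.size).sum - n := by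
  induction n with
  | zero => rfl
  | succ n ih => rw [Function.iterate_succ_apply', sum_size_traverse, ih]; omega

/-- The size of a tree, in unary notation. -/
theorem unary_size (h : PolyTimeFun i o) : PolyTimeFun i fun a => .unary (o a).size := by
  -- Each round removes exactly one node from the stack of pending trees, so the stack becomes empty
  -- after as many rounds as there are nodes.
  have hsum : ∀ a n, ((traverse^[n] [o a]).map Data.size).sum = (o a).size - n := fun a n => by
    rw [sum_size_iterate_traverse]
    simp
  have hnil : ∀ l : List Data, l = [] ↔ (l.map Data.size).sum = 0 := by
    rintro (_ | ⟨d, l⟩)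
    · simp
    · have := d.size_pos
      simp
      omega
  refine (iterate (s := fun a n => .cons (.ofList (traverse^[n] [o a])) (.unary n))
    (N := fun a => (o a).size) ?_ h.polyBdd ?_ ?_ ?_ ?_).snd
  · exact (h.cons nil).cons nil
  · refine (((h.polyBdd.precomp _).mul (PolyBdd.const 4)).add (PolyBdd.const 3)).of_le fun b => ?_
    have h₁ := hsum b.1.1 b.1.2
    have h₂ : ∀ l : List Data, (Data.ofList l).size ≤ 2 * (l.map Data.size).sum + 1 := by
      intro l
      induction l with
      | nil => simp [Data.ofList, Data.size]
      | cons d l ih =>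
        have := d.size_pos
        simp only [Data.ofList, Data.size, List.map_cons, List.sum_cons]
        omega
    have h₃ := h₂ (traverse^[b.1.2] [o b.1.1])
    have := b.2
    simp only [Data.size, Data.size_unary]
    omega
  · intro a n hn
    simp only [Data.head, ne_eq, Data.ofList_eq_nil, hnil, hsum]
    omega
  · intro a
    simp only [Data.head, Data.ofList_eq_nil, hnil, hsum]
    omega
  · refine (PolyTimePred.ite (PolyTimePred.isNil id.fst.head) (id.fst.tail.cons (nil.cons id.snd))
      ((id.fst.head.head.cons (id.fst.head.tail.cons id.fst.tail)).cons
        (nil.cons id.snd))).congr_fun fun b => ?_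
    have h₁ := hsum b.1.1 b.1.2
    have h₂ := b.2
    rw [Function.iterate_succ_apply', Data.unary_succ]
    generalize traverse^[b.1.2] [o b.1.1] = l at h₁ ⊢
    rcases l with _ | ⟨_ | ⟨x, y⟩, ds⟩
    · simp only [List.map_nil, List.sum_nil] at h₁
      omega
    · simp [traverse, Data.ofList, Data.head, Data.tail]
    · simp [traverse, Data.ofList, Data.head, Data.tail]

/-- Functions of finitely many inputs. -/
theorem of_finite (hi : (Set.range i).Finite) (ho : ∀ a b, i a = i b → o a = o b) :
    PolyTimeFun i o := by
  -- The induction is on the set of possible inputs and must allow any domain: after the comparison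
  -- with one input, the domain shrinks to a subtype.
  suffices H : ∀ (s : Finset Data) (α : Type) (i o : α → Data), (∀ a, i a ∈ s) →
      (∀ a b, i a = i b → o a = o b) → PolyTimeFun i o from
    H hi.toFinset α i o (fun a => by simp) ho
  classical
  intro s
  induction s using Finset.induction_on with
  -- Without possible inputs the domain is empty, and any program will do.
  | empty => exact fun α i o h _ => ⟨.setNil 0, 0, 0, fun a => by simpa using h a⟩
  | insert d s _ ih =>
    intro α i o h ho
    refine PolyTimePred.cases (PolyTimePred.eq_const id d) ?_ ?_
    · by_cases hd : ∃ a, i a = d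
      · obtain ⟨a, ha⟩ := hd
        exact (const (o a)).congr_fun fun b => ho _ _ (ha.trans b.2.symm)
      · exact ⟨.setNil 0, 0, 0, fun a => (hd ⟨a.1, a.2⟩).elim⟩
    · refine ih _ _ _ (fun a => ?_) fun a b hab => ho _ _ hab
      exact (Finset.mem_insert.1 (h a.1)).resolve_left a.2

/-- Multiplication by a power of two prepends zeros. This fails for zero, whose notation is the
empty list. -/
theorem binary_two_pow_mul (h₁ : PolyTimeFun i fun a => .unary (m a))
    (h₂ : PolyTimeFun i fun a => .binary (n a)) (hn : ∀ a, n a ≠ 0) :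
    PolyTimeFun i fun a => .binary (2 ^ m a * n a) :=
  (reverse_append (l₁ := fun a => List.replicate (m a) .nil)
    (l₂ := fun a => (n a).bits.map Data.ofBool) h₁ h₂).congr_fun fun a => by
      rw [Data.binary_two_pow_mul (hn a)]
      simp

end PolyTimeFun

/-- Equality is tested as two inequalities: dropping either number of entries from the other list
leaves nothing. -/
theorem PolyTimePred.unary_eq {α : Type} {i : α → Data} {m n : α → ℕ}
    (h₁ : PolyTimeFun i fun a => .unary (m a)) (h₂ : PolyTimeFun i fun a => .unary (n a)) :
    PolyTimePred i fun a => m a = n a := by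
  refine ((isNil (h₁.drop (l := fun a => List.replicate (m a) .nil) h₂)).and
    (isNil (h₂.drop (l := fun a => List.replicate (n a) .nil) h₁))).congr fun a => ?_
  simp only [Data.ofList_eq_nil, List.drop_eq_nil_iff, List.length_replicate]
  omega


/-! ## Expected utilities -/

namespace MAID

open Diagram

variable {M : MAID} {i : Fin M.numAgents}

theorem condProb_chance {v : Fin M.numVars} {cpd : M.RatRule v} (h : M.node v = .chance cpd)
    (π : M.Profile) (ω : M.Outcome) :
    condProb π ω v = ((cpd (ctx ω v)).prob (ω v)).toReal := by
  unfold condProb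
  split <;> simp_all

theorem condProb_decision {v : Fin M.numVars} {j : Fin M.numAgents} (h : M.node v = .decision j)
    (π : M.Profile) (ω : M.Outcome) : condProb π ω v = (π j v h (ctx ω v)).1 (ω v) := by
  unfold condProb
  split
  · simp_all
  · rename_i j' h'
    obtain rfl : j = j' := by simpa [h] using h'
    rfl
  · simp_all

theorem condProb_utility {v : Fin M.numVars} {j : Fin M.numAgents}
    {value : Fin (M.dom v) → Frac} {out : M.Ctx v → Fin (M.dom v)}
    (h : M.node v = .utility j value out) (π : M.Profile) (ω : M.Outcome) :
    condProb π ω v = if ω v = out (ctx ω v) then 1 else 0 := by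
  unfold condProb
  split <;> simp_all

theorem condProb_congr {v : Fin M.numVars} {π π' : M.Profile}
    (hπ : ∀ j (h : M.node v = .decision j), π j v h = π' j v h) (ω : M.Outcome) :
    condProb π ω v = condProb π' ω v := by
  cases h : M.node v with
  | chance cpd => rw [condProb_chance h, condProb_chance h]
  | decision j => rw [condProb_decision h, condProb_decision h, hπ]
  | utility j value out => rw [condProb_utility h, condProb_utility h]

theorem _root_.RatDist.prob_mem_Icc {m : ℕ} (p : RatDist m) (x : Fin m) :
    (p.prob x).toReal ∈ Set.Icc (0 : ℝ) 1 :=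
  ⟨p.mem_stdSimplex.1 x, p.mem_stdSimplex.2 ▸
    Finset.single_le_sum (f := fun d => (p.prob d).toReal)
      (fun d _ => p.mem_stdSimplex.1 d) (Finset.mem_univ x)⟩

theorem condProb_mem_Icc (π : M.Profile) (ω : M.Outcome) (v : Fin M.numVars) :
    condProb π ω v ∈ Set.Icc (0 : ℝ) 1 := by
  cases h : M.node v with
  | chance cpd => rw [condProb_chance h]; exact RatDist.prob_mem_Icc _ _
  | decision j =>
    rw [condProb_decision h]
    exact ⟨(π j v h (ctx ω v)).2.1 _, (π j v h (ctx ω v)).2.2 ▸ Finset.single_le_sum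
      (fun d _ => (π j v h (ctx ω v)).2.1 d) (Finset.mem_univ (ω v))⟩
  | utility j value out => rw [condProb_utility h]; split <;> simp

/-- The utility of agent `i` from the value `x` of the variable `v`. -/
noncomputable def payoff (i : Fin M.numAgents) (v : Fin M.numVars) (x : Fin (M.dom v)) : ℝ :=
  match M.node v with
  | .utility j value _ => if j = i then (value x).toReal else 0
  | _ => 0

theorem varUtility_eq (π : M.Profile) (i : Fin M.numAgents) (v : Fin M.numVars) :
    varUtility π i v = ∑ ω : M.Outcome, jointProb π ω * payoff i v (ω v) := by
  have key : ∀ g : Fin (M.dom v) → ℝ,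
      ∑ u, marginal π v u * g u = ∑ ω : M.Outcome, jointProb π ω * g (ω v) := by
    intro g
    rw [← Finset.sum_fiberwise Finset.univ fun ω : M.Outcome => ω v]
    refine Finset.sum_congr rfl fun u _ => ?_
    rw [marginal, Finset.sum_mul]
    refine Finset.sum_congr rfl fun ω hω => ?_
    rw [(Finset.mem_filter.1 hω).2]
  unfold varUtility payoff
  cases h : M.node v with
  | chance cpd => simp
  | decision j => simp
  | utility j value out =>
    by_cases hj : j = i
    · simpa [hj] using key _
    · simp [hj]

/-- This sum of products over outcomes is the form from which the linearity in each rule, the common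
denominator and the bound on the magnitude are all read off. -/
theorem expectedUtility_eq (π : M.Profile) (i : Fin M.numAgents) :
    expectedUtility π i = ∑ ω : M.Outcome, jointProb π ω * ∑ v, payoff i v (ω v) := by
  simp only [expectedUtility, varUtility_eq, Finset.mul_sum]
  exact Finset.sum_comm

/-! ### Pure policies suffice. -/

/-- Pure decision rules as behavioural ones. -/
noncomputable def pureRule {v : Fin M.numVars} (f : M.Ctx v → Fin (M.dom v)) : M.Rule v :=
  fun c => (RatDist.pure (f c)).toReal

theorem pureRule_apply {v : Fin M.numVars} (f : M.Ctx v → Fin (M.dom v)) (c : M.Ctx v)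
    (x : Fin (M.dom v)) : (pureRule f c).1 x = if x = f c then 1 else 0 := by
  simp only [pureRule, RatDist.toReal, RatDist.pure, Frac.toReal, Frac.ofNat]
  split <;> simp

theorem join_self (πi : M.Policy i) (π : M.PartialProfile i) : join πi π i = πi := by
  funext v h
  simp [join]

theorem join_of_ne (πi : M.Policy i) (π : M.PartialProfile i) {j : Fin M.numAgents} (hj : j ≠ i) :
    join πi π j = π j hj := by
  funext v h
  simp [join, hj]

theorem join_congr {πi πi' : M.Policy i} (π : M.PartialProfile i) {v : Fin M.numVars}
    (hπ : πi v = πi' v) (j : Fin M.numAgents) (h : M.node v = .decision j) :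
    join πi π j v h = join πi' π j v h := by
  by_cases hj : j = i
  · subst hj
    rw [join_self, join_self, hπ]
  · rw [join_of_ne _ _ hj, join_of_ne _ _ hj]

/-- The expected utility is an affine function of each decision rule. -/
theorem exists_expectedUtility_update_eq (πi : M.Policy i) (π : M.PartialProfile i)
    {v : Fin M.numVars} (hv : M.node v = .decision i) :
    ∃ H : M.Ctx v → Fin (M.dom v) → ℝ, ∀ ρ : M.Rule v,
      expectedUtility (join (Function.update πi v fun _ => ρ) π) i =
        ∑ c, ∑ x, (ρ c).1 x * H c x := by
  classical
  -- `K` is the part of the summand that does not involve the rule at `v`. The rule enters only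
  -- through the context and the value of `v`, so grouping the outcomes by these two exhibits the
  -- coefficients.
  let K : M.Outcome → ℝ := fun ω =>
    (∏ w ∈ Finset.univ.erase v, condProb (join πi π) ω w) * ∑ w, payoff i w (ω w)
  let φ : M.Outcome → M.Ctx v × Fin (M.dom v) := fun ω => (ctx ω v, ω v)
  refine ⟨fun c x => ∑ ω with φ ω = (c, x), K ω, fun ρ => ?_⟩
  rw [expectedUtility_eq, ← Fintype.sum_prod_type' (f := fun c x =>
    (ρ c).1 x * ∑ ω with φ ω = (c, x), K ω), ← Finset.sum_fiberwise Finset.univ φ]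
  refine Finset.sum_congr rfl fun y _ => ?_
  rw [Finset.mul_sum]
  refine Finset.sum_congr rfl fun ω hω => ?_
  have hy : φ ω = y := (Finset.mem_filter.1 hω).2
  subst hy
  rw [jointProb, ← Finset.mul_prod_erase _ _ (Finset.mem_univ v), condProb_decision hv,
    join_self, Function.update_self, mul_assoc]
  congr 2
  refine Finset.prod_congr rfl fun w hw => condProb_congr (fun j h => join_congr π ?_ j h) ω
  rw [Function.update_of_ne (Finset.ne_of_mem_erase hw)]

/-- A decision rule can be made pure without loss. -/
theorem exists_pureRule_le (πi : M.Policy i) (π : M.PartialProfile i)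
    {v : Fin M.numVars} (hv : M.node v = .decision i) :
    ∃ f : M.Ctx v → Fin (M.dom v), expectedUtility (join πi π) i ≤
      expectedUtility (join (Function.update πi v fun _ => pureRule f) π) i := by
  obtain ⟨H, hH⟩ := exists_expectedUtility_update_eq πi π hv
  -- By linearity each context can be treated separately: a value with the largest coefficient does
  -- at least as well as any average.
  have hmax : ∀ c, ∃ x, ∀ y, H c y ≤ H c x := fun c =>
    haveI : Nonempty (Fin (M.dom v)) := ⟨⟨0, by have := M.two_le_dom v; omega⟩⟩
    Finite.exists_max (H c)
  choose f hf using hmax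
  refine ⟨f, ?_⟩
  have hself : Function.update πi v (fun _ => πi v hv) = πi := by
    funext w h
    by_cases hw : w = v
    · subst hw
      rw [Function.update_self]
    · rw [Function.update_of_ne hw]
  conv_lhs => rw [← hself]
  rw [hH, hH]
  refine Finset.sum_le_sum fun c _ => ?_
  simp only [pureRule_apply, ite_mul, one_mul, zero_mul, Finset.sum_ite_eq', Finset.mem_univ,
    if_true]
  calc ∑ x, (πi v hv c).1 x * H c x ≤ ∑ x, (πi v hv c).1 x * H c (f c) :=
        Finset.sum_le_sum fun x _ => mul_le_mul_of_nonneg_left (hf c x) ((πi v hv c).2.1 x)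
    _ = H c (f c) := by rw [← Finset.sum_mul, (πi v hv c).2.2, one_mul]

variable (M) in
/-- A pure decision rule for each variable. -/
abbrev PureRules : Type := (v : Fin M.numVars) → M.Ctx v → Fin (M.dom v)

/-- The policy that follows pure decision rules. -/
noncomputable def purePolicy (i : Fin M.numAgents) (F : M.PureRules) : M.Policy i :=
  fun v _ => pureRule (F v)

/-- The policy that follows pure rules for the first `n` variables, and `πi` elsewhere. -/
noncomputable def mixPolicy (F : M.PureRules) (n : ℕ) (πi : M.Policy i) : M.Policy i :=
  fun v h => if v.1 < n then pureRule (F v) else πi v h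

theorem mixPolicy_of_lt (F : M.PureRules) {n : ℕ} (πi : M.Policy i) {v : Fin M.numVars}
    (hv : v.1 < n) (h : M.node v = .decision i) : mixPolicy F n πi v h = pureRule (F v) :=
  if_pos hv

theorem mixPolicy_of_le (F : M.PureRules) {n : ℕ} (πi : M.Policy i) {v : Fin M.numVars}
    (hv : n ≤ v.1) (h : M.node v = .decision i) : mixPolicy F n πi v h = πi v h :=
  if_neg (not_lt.2 hv)

theorem mixPolicy_zero (F : M.PureRules) (πi : M.Policy i) : mixPolicy F 0 πi = πi := by
  funext v h
  simp [mixPolicy]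

theorem mixPolicy_numVars (F : M.PureRules) (πi : M.Policy i) :
    mixPolicy F M.numVars πi = purePolicy i F := by
  funext v h
  simp [mixPolicy, purePolicy]

theorem mixPolicy_succ (F : M.PureRules) {v : Fin M.numVars} (hv : M.node v ≠ .decision i)
    (πi : M.Policy i) : mixPolicy F (v.1 + 1) πi = mixPolicy F v.1 πi := by
  funext w h
  have : w ≠ v := by
    rintro rfl
    exact hv h
  have : w.1 ≠ v.1 := fun h => this (Fin.ext h)
  by_cases hw : w.1 < v.1
  · simp [mixPolicy, hw, show w.1 < v.1 + 1 by omega]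
  · simp [mixPolicy, hw, show ¬ w.1 < v.1 + 1 by omega]

theorem mixPolicy_succ_update (F : M.PureRules) (v : Fin M.numVars)
    (f : M.Ctx v → Fin (M.dom v)) (πi : M.Policy i) :
    mixPolicy (Function.update F v f) (v.1 + 1) πi =
      Function.update (mixPolicy F v.1 πi) v fun _ => pureRule f := by
  funext w h
  by_cases hw : w = v
  · subst hw
    simp [mixPolicy]
  · have : w.1 ≠ v.1 := fun h => hw (Fin.ext h)
    rw [Function.update_of_ne hw]
    by_cases hw' : w.1 < v.1
    · simp [mixPolicy, hw, hw', show w.1 < v.1 + 1 by omega]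
    · simp [mixPolicy, hw', show ¬ w.1 < v.1 + 1 by omega]

instance : Nonempty M.PureRules := ⟨fun v _ => ⟨0, by have := M.two_le_dom v; omega⟩⟩

/-- The rules are made pure one at a time, in the order of the variable indices; each replacement
holds all other rules fixed, so the order is immaterial. -/
theorem exists_purePolicy_le (πi : M.Policy i) (π : M.PartialProfile i) :
    ∃ F : M.PureRules,
      expectedUtility (join πi π) i ≤ expectedUtility (join (purePolicy i F) π) i := by
  suffices H : ∀ n ≤ M.numVars, ∃ F : M.PureRules,
      expectedUtility (join πi π) i ≤ expectedUtility (join (mixPolicy F n πi) π) i by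
    simpa only [mixPolicy_numVars] using H _ le_rfl
  intro n
  induction n with
  | zero => exact fun _ => ⟨Classical.arbitrary _, by rw [mixPolicy_zero]⟩
  | succ n ih =>
    intro hn
    obtain ⟨F, hF⟩ := ih (by omega)
    let v : Fin M.numVars := ⟨n, hn⟩
    by_cases hv : M.node v = .decision i
    · obtain ⟨f, hf⟩ := exists_pureRule_le (mixPolicy F v.1 πi) π hv
      exact ⟨Function.update F v f, hF.trans (by rwa [← mixPolicy_succ_update] at hf)⟩
    · exact ⟨F, hF.trans_eq (by rw [← mixPolicy_succ F hv])⟩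

/-! ## Fixing decisions -/

open Classical in
variable (M) in
/-- The MAID in which the decisions of agent `i` among the first `n` variables have become chance
variables that follow the pure decision rules `F`. -/
@[reducible] noncomputable def fixBelow (i : Fin M.numAgents) (F : M.PureRules) (n : ℕ) : MAID :=
  { M with node := fun v => if v.1 < n ∧ M.node v = .decision i then
      .chance fun c => RatDist.pure (F v c) else M.node v }

theorem node_fixBelow_of_not (F : M.PureRules) (n : ℕ) {v : Fin M.numVars}
    (h : ¬ (v.1 < n ∧ M.node v = .decision i)) : (M.fixBelow i F n).node v = M.node v := if_neg h

theorem node_fixBelow (F : M.PureRules) (n : ℕ) {v : Fin M.numVars}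
    (h : v.1 < n ∧ M.node v = .decision i) :
    (M.fixBelow i F n).node v = .chance fun c => RatDist.pure (F v c) := if_pos h

theorem node_of_node_fixBelow {F : M.PureRules} {n : ℕ} {v : Fin M.numVars}
    {j : Fin M.numAgents} (h : (M.fixBelow i F n).node v = .decision j) :
    M.node v = .decision j := by
  by_cases hv : v.1 < n ∧ M.node v = .decision i
  · rw [node_fixBelow F n hv] at h
    cases h
  · rwa [node_fixBelow_of_not F n hv] at h

end MAID

/-- The instance in which the decisions among the first `n` variables have been fixed. -/
@[reducible] noncomputable def BestResponseInput.fixBelow (x : BestResponseInput)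
    (F : x.M.PureRules) (n : ℕ) :
    BestResponseInput where
  M := x.M.fixBelow x.i F n
  i := x.i
  π := fun j hj v h => x.π j hj v (MAID.node_of_node_fixBelow h)

namespace BestResponseInput

open MAID

variable (x : BestResponseInput)

/-- The expected utility of the distinguished agent. -/
noncomputable def value (πi : x.M.Policy x.i) : ℝ :=
  expectedUtility (join πi (RatPartialProfile.toReal x.π)) x.i

variable {x}

/-- A chance variable following a pure rule has the same conditional probabilities as a decision
following it, and neither kind of variable pays utility. The two policies take proofs about
different MAIDs as arguments, so they are compared rule by rule at the decisions that are still
open. -/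
theorem value_fixBelow (F : x.M.PureRules) (n : ℕ) (ϖ : (x.fixBelow F n).M.Policy x.i)
    (πi : x.M.Policy x.i) (h : ∀ (v : Fin x.M.numVars) (h : x.M.node v = .decision x.i)
      (h' : (x.fixBelow F n).M.node v = .decision x.i), n ≤ v.1 → ϖ v h' = πi v h) :
    (x.fixBelow F n).value ϖ = x.value (mixPolicy F n πi) := by
  have hc : ∀ (ω : x.M.Outcome) (v : Fin x.M.numVars),
      condProb (M := x.M.fixBelow x.i F n)
        (join ϖ (RatPartialProfile.toReal (x.fixBelow F n).π)) ω v =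
      condProb (join (mixPolicy F n πi) (RatPartialProfile.toReal x.π)) ω v := by
    intro ω v
    by_cases hv : v.1 < n ∧ x.M.node v = .decision x.i
    · rw [condProb_chance (node_fixBelow F n hv), condProb_decision hv.2, join_self,
        mixPolicy_of_lt F πi hv.1]
      rfl
    · have hn := node_fixBelow_of_not F n hv
      cases hw : x.M.node v with
      | chance cpd => rw [condProb_chance hw, condProb_chance (hn.trans hw)]
      | utility j value out => rw [condProb_utility hw, condProb_utility (hn.trans hw)]
      | decision j =>
        rw [condProb_decision hw, condProb_decision (hn.trans hw)]
        by_cases hj : j = x.i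
        · subst hj
          have hvn : ¬ v.1 < n := fun hvn => hv ⟨hvn, hw⟩
          have := h v hw (hn.trans hw) (not_lt.1 hvn)
          rw [join_self (M := x.M), mixPolicy_of_le F πi (not_lt.1 hvn), ← this]
          exact congrArg (fun r : x.M.Rule v => (r (Diagram.ctx ω v)).1 (ω v))
            (congrFun (congrFun (join_self (M := x.M.fixBelow x.i F n) ϖ _) v) (hn.trans hw))
        · rw [join_of_ne _ _ hj]
          exact congrArg (fun r : x.M.Rule v => (r (Diagram.ctx ω v)).1 (ω v))
            (congrFun (congrFun (join_of_ne (M := x.M.fixBelow x.i F n) ϖ _ hj) v) (hn.trans hw))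
  have hp : ∀ (v : Fin x.M.numVars) (y : Fin (x.M.dom v)),
      payoff (M := x.M.fixBelow x.i F n) x.i v y = payoff (M := x.M) x.i v y := by
    intro v y
    by_cases hv : v.1 < n ∧ x.M.node v = .decision x.i
    · unfold payoff
      rw [node_fixBelow F n hv, hv.2]
    · unfold payoff
      rw [node_fixBelow_of_not F n hv]
      cases x.M.node v <;> rfl
  unfold value
  rw [expectedUtility_eq, expectedUtility_eq]
  refine Finset.sum_congr rfl fun ω _ => ?_
  congr 1
  · exact Finset.prod_congr rfl fun v _ => hc ω v
  · exact Finset.sum_congr rfl fun v _ => hp v (ω v)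

theorem question_iff (q : Frac) :
    (IsBestResponseInput.mk x q).question ↔ ∃ πi, q.toReal < x.value πi := Iff.rfl

/-- Questions about the modified instance become questions about the original one, with the policies
restricted to those that follow `F` below `n`. -/
theorem question_fixBelow_iff (F : x.M.PureRules) (n : ℕ) (q : Frac) :
    (IsBestResponseInput.mk (x.fixBelow F n) q).question ↔
      ∃ πi, q.toReal < x.value (mixPolicy F n πi) := by
  rw [question_iff]
  constructor
  · rintro ⟨ϖ, h⟩
    -- Below `n` the policy `ϖ` has no rule to offer. The rule supplied there is immaterial, since
    -- `mixPolicy` overrides it.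
    refine ⟨fun v h => if hv : v.1 < n then pureRule (F v) else
      ϖ v ((node_fixBelow_of_not F n fun h => hv h.1).trans h), ?_⟩
    rwa [← value_fixBelow F n ϖ _ fun v h h' hv => by
      split
      · exact absurd ‹_› (not_lt.2 hv)
      · rfl]
  · rintro ⟨πi, h⟩
    refine ⟨fun v h => πi v (node_of_node_fixBelow h), ?_⟩
    exact h.trans_eq (value_fixBelow F n _ πi fun v h h' hv => rfl).symm

/-- A policy that exceeds `q` can be made pure at `v` without loss, so the search among pure rules
for `v` never reaches a dead end. -/
theorem question_fixBelow_succ {F : x.M.PureRules} {v : Fin x.M.numVars}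
    (hv : x.M.node v = .decision x.i) {q : Frac}
    (h : (IsBestResponseInput.mk (x.fixBelow F v.1) q).question) :
    ∃ f, (IsBestResponseInput.mk (x.fixBelow (Function.update F v f) (v.1 + 1)) q).question := by
  simp only [question_fixBelow_iff] at h ⊢
  obtain ⟨πi, h⟩ := h
  obtain ⟨f, hf⟩ := exists_pureRule_le (mixPolicy F v.1 πi) (RatPartialProfile.toReal x.π) hv
  exact ⟨f, πi, by rw [mixPolicy_succ_update]; exact h.trans_le hf⟩

theorem question_fixBelow_succ_of_ne {F : x.M.PureRules} {v : Fin x.M.numVars}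
    (hv : x.M.node v ≠ .decision x.i) {q : Frac}
    (h : (IsBestResponseInput.mk (x.fixBelow F v.1) q).question) :
    (IsBestResponseInput.mk (x.fixBelow F (v.1 + 1)) q).question := by
  simp only [question_fixBelow_iff] at h ⊢
  simpa only [mixPolicy_succ F hv] using h

theorem boundedDecisions_fixBelow {k b : ℕ} (h : x.M.BoundedDecisions x.i k b)
    (F : x.M.PureRules) (n : ℕ) : (x.fixBelow F n).M.BoundedDecisions (x.fixBelow F n).i k b :=
  fun v hv => h v (node_of_node_fixBelow hv)

/-- Passing from `n` to `n + 1` fixes at most one decision, to which closure of the class applies;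
otherwise the MAID does not change. -/
theorem closed_fixBelow {𝒞 : (M : MAID) → Fin M.numAgents → Prop} (h𝒞 : ClosedUnderFixing 𝒞)
    (h : 𝒞 x.M x.i) (F : x.M.PureRules) (n : ℕ) : 𝒞 (x.fixBelow F n).M (x.fixBelow F n).i := by
  change 𝒞 (x.M.fixBelow x.i F n) x.i
  -- Only the nodes differ between the MAIDs involved. Moving membership along an equality of node
  -- functions over one diagram avoids transporting the agent along an equality of MAIDs.
  have hnode : ∀ node' : (v : Fin x.M.numVars) → x.M.toDiagram.Node v,
      (x.M.fixBelow x.i F n).node = node' → 𝒞 ⟨x.M.toDiagram, node'⟩ x.i →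
        𝒞 (x.M.fixBelow x.i F n) x.i := by
    rintro _ rfl h
    exact h
  induction n with
  | zero =>
    refine hnode x.M.node ?_ h
    funext v
    exact node_fixBelow_of_not F 0 (by simp)
  | succ n ih =>
    have ih := ih fun node' hn h => by
      subst hn
      exact h
    by_cases hn : ∃ hn : n < x.M.numVars, x.M.node ⟨n, hn⟩ = .decision x.i
    · obtain ⟨hn, hv⟩ := hn
      have hv' : (x.M.fixBelow x.i F n).node ⟨n, hn⟩ = .decision x.i :=
        (node_fixBelow_of_not F n (by simp)).trans hv
      refine hnode _ ?_ (h𝒞 (x.M.fixBelow x.i F n) x.i ⟨n, hn⟩ (F ⟨n, hn⟩) ih hv')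
      funext w
      by_cases hw : w = ⟨n, hn⟩
      · subst hw
        rw [Function.update_self]
        exact node_fixBelow F _ ⟨by simp, hv⟩
      · have hwn : w.1 ≠ n := fun h => hw (Fin.ext h)
        rw [Function.update_of_ne hw]
        by_cases hw' : w.1 < n ∧ x.M.node w = .decision x.i
        · rw [node_fixBelow F n hw', node_fixBelow F _ ⟨by omega, hw'.2⟩]
        · rw [node_fixBelow_of_not F n hw', node_fixBelow_of_not F _ fun h => hw' ⟨by omega, h.2⟩]
    · refine hnode _ ?_ ih
      funext w
      by_cases hw' : w.1 < n ∧ x.M.node w = .decision x.i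
      · exact (node_fixBelow F _ ⟨by omega, hw'.2⟩).trans (node_fixBelow F n hw').symm
      · refine (node_fixBelow_of_not F _ fun h => hw' ⟨?_, h.2⟩).trans
          (node_fixBelow_of_not F n hw').symm
        have : w.1 ≠ n := by
          intro hwn
          have e : (⟨n, hwn ▸ w.2⟩ : Fin x.M.numVars) = w := Fin.ext hwn.symm
          exact hn ⟨_, by rw [e]; exact h.2⟩
        omega

end BestResponseInput


/-! ## Denominators and magnitudes -/

/-- This turns a sum of utilities into a product, so that bounds 2 ^ size for the single variables
combine into one for the whole description. -/
theorem Finset.one_add_sum_le_prod_one_add {ι : Type} (s : Finset ι) {f : ι → ℝ}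
    (hf : ∀ a, 0 ≤ f a) : 1 + ∑ a ∈ s, f a ≤ ∏ a ∈ s, (1 + f a) := by
  classical
  induction s using Finset.induction_on with
  | empty => simp
  | insert a s ha ih =>
    rw [Finset.sum_insert ha, Finset.prod_insert ha]
    have h₁ := hf a
    have h₂ : 0 ≤ ∑ b ∈ s, f b := Finset.sum_nonneg fun b _ => hf b
    nlinarith [mul_nonneg h₁ h₂]

/-- The real number `r` is an integer multiple of `1 / D`. -/
def HasDenom (D : ℕ) (r : ℝ) : Prop := ∃ z : ℤ, r * D = z

namespace HasDenom

variable {D E : ℕ} {r s : ℝ}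

theorem of_int (z : ℤ) (D : ℕ) : HasDenom D z := ⟨z * D, by push_cast; rfl⟩

theorem zero (D : ℕ) : HasDenom D 0 := by simpa using of_int 0 D

theorem one (D : ℕ) : HasDenom D 1 := by simpa using of_int 1 D

theorem of_dvd (h : HasDenom D r) (hD : D ∣ E) : HasDenom E r := by
  obtain ⟨z, hz⟩ := h
  obtain ⟨k, rfl⟩ := hD
  exact ⟨z * k, by push_cast; rw [← hz]; ring⟩

theorem add (hr : HasDenom D r) (hs : HasDenom D s) : HasDenom D (r + s) := by
  obtain ⟨y, hy⟩ := hr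
  obtain ⟨z, hz⟩ := hs
  exact ⟨y + z, by push_cast; rw [← hy, ← hz]; ring⟩

theorem sub (hr : HasDenom D r) (hs : HasDenom D s) : HasDenom D (r - s) := by
  obtain ⟨y, hy⟩ := hr
  obtain ⟨z, hz⟩ := hs
  exact ⟨y - z, by push_cast; rw [← hy, ← hz]; ring⟩

theorem mul (hr : HasDenom D r) (hs : HasDenom E s) : HasDenom (D * E) (r * s) := by
  obtain ⟨y, hy⟩ := hr
  obtain ⟨z, hz⟩ := hs
  exact ⟨y * z, by push_cast; rw [← hy, ← hz]; ring⟩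

theorem sum {ι : Type} {t : Finset ι} {f : ι → ℝ} (h : ∀ a ∈ t, HasDenom D (f a)) :
    HasDenom D (∑ a ∈ t, f a) :=
  Finset.sum_induction f (HasDenom D) (fun _ _ => add) (zero D) h

theorem prod {ι : Type} [DecidableEq ι] {t : Finset ι} {f : ι → ℝ} {N : ι → ℕ}
    (h : ∀ a ∈ t, HasDenom (N a) (f a)) : HasDenom (∏ a ∈ t, N a) (∏ a ∈ t, f a) := by
  induction t using Finset.induction_on with
  | empty => simpa using one 1
  | insert a t ha ih =>
    rw [Finset.prod_insert ha, Finset.prod_insert ha]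
    exact (h a (by simp)).mul (ih fun b hb => h b (by simp [hb]))

theorem eq_zero (h : HasDenom D r) (h₀ : 0 ≤ r) (h₁ : r * D < 1) : r * D = 0 := by
  obtain ⟨z, hz⟩ := h
  have h₂ : (0 : ℝ) ≤ r * D := by positivity
  rw [hz] at h₁ h₂ ⊢
  have : z < 1 := by exact_mod_cast h₁
  have : 0 ≤ z := by exact_mod_cast h₂
  obtain rfl : z = 0 := by omega
  simp

end HasDenom

namespace Data

/-- The sizes of the entries add up inside the encoded list, so the powers of two multiply. -/
theorem prod_le_two_pow_size_ofFn {n : ℕ} {f : Fin n → ℕ} {d : Fin n → Data}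
    (h : ∀ k, f k ≤ 2 ^ (d k).size) : ∏ k, f k ≤ 2 ^ (ofList (List.ofFn d)).size := by
  refine (Finset.prod_le_prod' fun k _ => h k).trans ?_
  rw [Finset.prod_pow_eq_pow_sum, size_ofList, List.map_ofFn, List.sum_ofFn]
  refine Nat.pow_le_pow_right (by norm_num) ((Finset.sum_le_sum fun k _ => ?_).trans
    (Nat.le_succ _))
  simp

theorem le_two_pow_of_mem {l : List Data} {d : Data} {n : ℕ} (hd : d ∈ l)
    (h : n ≤ 2 ^ d.size) : n ≤ 2 ^ (ofList l).size :=
  h.trans (Nat.pow_le_pow_right (by norm_num) (size_le_of_mem hd).le)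

theorem le_two_pow_cons_left {d e : Data} {n : ℕ} (h : n ≤ 2 ^ d.size) :
    n ≤ 2 ^ (cons d e).size :=
  h.trans (Nat.pow_le_pow_right (by norm_num) (by simp only [size]; omega))

theorem le_two_pow_cons_right {d e : Data} {n : ℕ} (h : n ≤ 2 ^ e.size) :
    n ≤ 2 ^ (cons d e).size :=
  h.trans (Nat.pow_le_pow_right (by norm_num) (by simp only [size]; omega))

end Data

namespace Frac

theorem hasDenom (q : Frac) : HasDenom q.den q.toReal :=
  ⟨q.num, div_mul_cancel₀ _ (by exact_mod_cast q.den_pos.ne')⟩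

theorem den_le (q : Frac) : q.den ≤ 2 ^ q.enc.size :=
  Data.le_two_pow_cons_right (Data.lt_two_pow_size_binary _).le

theorem abs_toReal_add_one_le (q : Frac) : |q.toReal| + 1 ≤ 2 ^ q.enc.size := by
  have h₁ : q.num.natAbs + 1 ≤ 2 ^ q.enc.size :=
    Data.le_two_pow_cons_left (Data.le_two_pow_cons_right (Data.lt_two_pow_size_binary _))
  have h₂ : |q.toReal| ≤ (q.num.natAbs : ℝ) := by
    rw [toReal, abs_div, Nat.cast_natAbs, Int.cast_abs]
    refine div_le_self (abs_nonneg _) ?_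
    rw [Nat.abs_cast]
    exact_mod_cast q.den_pos
  have h₃ : (q.num.natAbs : ℝ) + 1 ≤ 2 ^ q.enc.size := by exact_mod_cast h₁
  linarith

end Frac

/-- A common denominator of the probabilities. -/
def RatDist.denom {m : ℕ} (p : RatDist m) : ℕ := ∏ x, (p.prob x).den

theorem RatDist.hasDenom {m : ℕ} (p : RatDist m) (x : Fin m) :
    HasDenom p.denom (p.prob x).toReal :=
  (p.prob x).hasDenom.of_dvd (Finset.dvd_prod_of_mem _ (Finset.mem_univ x))

theorem RatDist.denom_le {m : ℕ} (p : RatDist m) : p.denom ≤ 2 ^ p.enc.size :=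
  Data.prod_le_two_pow_size_ofFn fun x => (p.prob x).den_le

namespace Diagram

variable {G : Diagram} {v : Fin G.numVars}

/-- A common denominator of the entries of a table. -/
def RatRule.denom (c : G.RatRule v) : ℕ := ∏ r, (c (finPiFinEquiv.symm r)).denom

theorem RatRule.hasDenom (c : G.RatRule v) (y : G.Ctx v) (x : Fin (G.dom v)) :
    HasDenom (RatRule.denom c) ((c y).prob x).toReal := by
  refine ((c y).hasDenom x).of_dvd ?_
  have := Finset.dvd_prod_of_mem (fun r => (c (finPiFinEquiv.symm r)).denom)
    (Finset.mem_univ (finPiFinEquiv y))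
  rwa [Equiv.symm_apply_apply] at this

theorem RatRule.denom_pos (c : G.RatRule v) : 0 < RatRule.denom c :=
  Finset.prod_pos fun _ _ => Finset.prod_pos fun _ _ => Frac.den_pos _

theorem RatRule.denom_le (c : G.RatRule v) :
    RatRule.denom c ≤ 2 ^ (encTable RatDist.enc c).size :=
  Data.prod_le_two_pow_size_ofFn fun _ => RatDist.denom_le _

/-- A common denominator of the parameters of a variable. -/
def Node.denom : G.Node v → ℕ
  | .chance c => RatRule.denom c
  | .decision _ => 1
  | .utility _ value _ => ∏ u, (value u).den

theorem Node.denom_le (N : G.Node v) : N.denom ≤ 2 ^ N.enc.size := by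
  cases N with
  | chance c => exact Data.le_two_pow_of_mem (by simp) (RatRule.denom_le c)
  | decision j => exact Nat.one_le_two_pow
  | utility j value out =>
    exact Data.le_two_pow_of_mem (l := [_, _, _, _]) (d := .ofList (List.ofFn fun u => (value u).enc))
      (by simp) (Data.prod_le_two_pow_size_ofFn fun u => (value u).den_le)

end Diagram

namespace MAID

open Diagram

variable {M : MAID}

variable (M) in
/-- The description of one variable. -/
def varEnc (v : Fin M.numVars) : Data :=
  .ofList [.unary (M.dom v), .ofList ((M.parents v).map fun u : Fin M.numVars => Data.unary u.1),
    (M.node v).enc]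

theorem enc_eq : M.enc = .cons (.unary M.numAgents) (.ofList (List.ofFn M.varEnc)) := by
  unfold enc varEnc
  congr 3
  funext v
  congr 3
  simp [← List.map_eq_flatMap, Function.comp_def]

variable (M) in
/-- A common denominator of the parameters of a MAID. -/
def denom : ℕ := ∏ v, (M.node v).denom

theorem denom_le : M.denom ≤ 2 ^ M.enc.size :=
  enc_eq (M := M) ▸ Data.le_two_pow_cons_right <| Data.prod_le_two_pow_size_ofFn fun v =>
    Data.le_two_pow_of_mem (d := (M.node v).enc) (by simp) (Node.denom_le _)

variable {i : Fin M.numAgents}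

open Classical in
/-- A common denominator of the probabilities in the rule for the variable `v` in the policy of
agent `j`. -/
noncomputable def RatPartialProfile.varDenom (π : M.RatPartialProfile i) (j : Fin M.numAgents)
    (v : Fin M.numVars) : ℕ :=
  if hj : j = i then 1 else if h : M.node v = .decision j then RatRule.denom (π j hj v h) else 1

theorem RatPartialProfile.prod_varDenom_le (π : M.RatPartialProfile i) :
    ∏ j, ∏ v, π.varDenom j v ≤ 2 ^ (RatPartialProfile.enc π).size := by
  refine Data.prod_le_two_pow_size_ofFn fun j => ?_
  by_cases hj : j = i
  · simp [varDenom, hj, Nat.one_le_two_pow]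
  · rw [dif_neg hj]
    refine Data.prod_le_two_pow_size_ofFn fun v => ?_
    by_cases h : M.node v = .decision j
    · rw [varDenom, dif_neg hj, dif_pos h, dif_pos h]
      exact RatRule.denom_le _
    · rw [varDenom, dif_neg hj, dif_neg h, dif_neg h]
      exact Nat.one_le_two_pow

/-- The probabilities come from the node's own table, from the table of another agent, or are 0 or
1. The product over all agents gives a denominator that does not depend on whose decision the
variable is. -/
theorem hasDenom_condProb (F : M.PureRules) (π : M.RatPartialProfile i) (ω : M.Outcome)
    (v : Fin M.numVars) : HasDenom ((M.node v).denom * ∏ j, π.varDenom j v)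
      (condProb (join (purePolicy i F) π.toReal) ω v) := by
  cases h : M.node v with
  | chance cpd =>
    rw [condProb_chance h]
    exact (RatRule.hasDenom cpd _ _).of_dvd (Dvd.intro _ rfl)
  | decision j =>
    rw [condProb_decision h]
    by_cases hj : j = i
    · subst hj
      rw [join_self, purePolicy, pureRule_apply]
      split
      · exact HasDenom.one _
      · exact HasDenom.zero _
    · rw [join_of_ne _ _ hj]
      have h₁ : HasDenom (π.varDenom j v) ((π j hj v h (ctx ω v)).prob (ω v)).toReal := by
        rw [RatPartialProfile.varDenom, dif_neg hj, dif_pos h]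
        exact RatRule.hasDenom _ _ _
      exact h₁.of_dvd ((Finset.dvd_prod_of_mem (fun j => π.varDenom j v)
        (Finset.mem_univ j)).mul_left _)
  | utility j value out =>
    rw [condProb_utility h]
    split
    · exact HasDenom.one _
    · exact HasDenom.zero _

theorem hasDenom_payoff (v : Fin M.numVars) (x : Fin (M.dom v)) :
    HasDenom (M.node v).denom (payoff i v x) := by
  unfold payoff
  cases h : M.node v with
  | chance cpd => exact HasDenom.zero _
  | decision j => exact HasDenom.zero _
  | utility j value out =>
    by_cases hj : j = i
    · simp only [hj, if_true]
      exact (value x).hasDenom.of_dvd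
        (Finset.dvd_prod_of_mem (fun u => (value u).den) (Finset.mem_univ x))
    · simpa [hj] using HasDenom.zero _

theorem abs_payoff_add_one_le (v : Fin M.numVars) (x : Fin (M.dom v)) :
    |payoff i v x| + 1 ≤ 2 ^ (M.varEnc v).size := by
  have h1 : ∀ n : ℕ, |(0 : ℝ)| + 1 ≤ 2 ^ n := fun n => by
    simpa using one_le_pow₀ (M₀ := ℝ) (by norm_num : (1 : ℝ) ≤ 2)
  unfold payoff
  cases h : M.node v with
  | chance cpd => exact h1 _
  | decision j => exact h1 _
  | utility j value out =>
    by_cases hj : j = i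
    · simp only [hj, if_true]
      refine (value x).abs_toReal_add_one_le.trans (pow_le_pow_right₀ (by norm_num) ?_)
      have h₁ : (value x).enc.size < (Data.ofList (List.ofFn fun u => (value u).enc)).size :=
        Data.size_le_of_mem (by simp)
      have h₂ : (Data.ofList (List.ofFn fun u => (value u).enc)).size < (M.node v).enc.size := by
        rw [h]
        exact Data.size_le_of_mem (by simp)
      have h₃ : (M.node v).enc.size < (M.varEnc v).size := Data.size_le_of_mem (by simp)
      omega
    · simpa [hj] using h1 _

theorem card_outcome_le : Fintype.card M.Outcome ≤ 2 ^ M.enc.size := by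
  rw [Fintype.card_pi, enc_eq]
  refine Data.le_two_pow_cons_right (Data.prod_le_two_pow_size_ofFn fun v => ?_)
  refine Data.le_two_pow_of_mem (d := .unary (M.dom v)) (by simp) ?_
  rw [Fintype.card_fin, Data.size_unary]
  exact Nat.lt_two_pow_self.le.trans (Nat.pow_le_pow_right (by norm_num) (by omega))

theorem abs_sum_payoff_lt (ω : M.Outcome) :
    |∑ v, payoff i v (ω v)| + 1 ≤ 2 ^ M.enc.size := by
  have h₁ : 1 + ∑ v, |payoff i v (ω v)| ≤ ∏ v, (1 + |payoff i v (ω v)|) :=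
    Finset.one_add_sum_le_prod_one_add _ fun v => abs_nonneg _
  have h₂ : ∏ v, (1 + |payoff i v (ω v)|) ≤ ∏ v, (2 : ℝ) ^ (M.varEnc v).size :=
    Finset.prod_le_prod (fun v _ => by positivity) fun v _ => by
      rw [add_comm]
      exact abs_payoff_add_one_le v (ω v)
  have h₃ : ∏ v, 2 ^ (M.varEnc v).size ≤ 2 ^ M.enc.size :=
    enc_eq (M := M) ▸ Data.le_two_pow_cons_right (Data.prod_le_two_pow_size_ofFn fun v => le_rfl)
  have h₄ : ∏ v, (2 : ℝ) ^ (M.varEnc v).size ≤ 2 ^ M.enc.size := by exact_mod_cast h₃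
  have h₅ := Finset.abs_sum_le_sum_abs (fun v => payoff i v (ω v)) Finset.univ
  linarith

end MAID

namespace BestResponseInput

open MAID

variable {x : BestResponseInput}

theorem size_enc_le : x.M.enc.size + (RatPartialProfile.enc x.π).size ≤ x.enc.size := by
  simp only [enc, Data.ofList, Data.size]
  omega

/-- The size of the instance bounds the logarithms of all denominators and utilities. -/
theorem exists_hasDenom_value :
    ∃ D : ℕ, 0 < D ∧ D ≤ 2 ^ (2 * x.enc.size) ∧ ∀ F, HasDenom D (x.value (purePolicy x.i F)) := by
  have hpos : 0 < x.M.denom := by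
    refine Finset.prod_pos fun v _ => ?_
    cases x.M.node v with
    | chance c => exact Diagram.RatRule.denom_pos c
    | decision j => exact Nat.one_pos
    | utility j value out => exact Finset.prod_pos fun u _ => Frac.den_pos _
  have hpos' : 0 < ∏ j, ∏ v, x.π.varDenom j v := by
    refine Finset.prod_pos fun j _ => Finset.prod_pos fun v _ => ?_
    unfold RatPartialProfile.varDenom
    split
    · exact Nat.one_pos
    · split
      · exact Diagram.RatRule.denom_pos _
      · exact Nat.one_pos
  -- The first two factors clear the joint probability, the last one clears the sum of the
  -- utilities.
  refine ⟨(x.M.denom * ∏ j, ∏ v, x.π.varDenom j v) * x.M.denom, by positivity, ?_, fun F => ?_⟩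
  · calc _ ≤ (2 ^ x.M.enc.size * 2 ^ (RatPartialProfile.enc x.π).size) * 2 ^ x.M.enc.size := by
          gcongr
          · exact denom_le
          · exact RatPartialProfile.prod_varDenom_le _
          · exact denom_le
      _ ≤ _ := by
          rw [← pow_add, ← pow_add]
          have := size_enc_le (x := x)
          exact Nat.pow_le_pow_right (by norm_num) (by omega)
  · rw [value, expectedUtility_eq]
    refine HasDenom.sum fun ω _ => HasDenom.mul ?_ (HasDenom.sum fun v _ =>
      (hasDenom_payoff v (ω v)).of_dvd
        (Finset.dvd_prod_of_mem (fun v => (x.M.node v).denom) (Finset.mem_univ v)))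
    rw [Finset.prod_comm, MAID.denom, ← Finset.prod_mul_distrib]
    exact HasDenom.prod fun v _ => hasDenom_condProb F x.π ω v

/-- A crude count suffices: with m the size of the MAID, there are at most 2 ^ m outcomes, each
weighted by at most 1 and paying at most 2 ^ m - 1 in absolute value. That the weights sum to 1 is
not needed. -/
theorem abs_value_lt (πi : x.M.Policy x.i) : |x.value πi| < 2 ^ (2 * x.enc.size) := by
  have h₁ : |x.value πi| ≤ ∑ _ω : x.M.Outcome, ((2 : ℝ) ^ x.M.enc.size - 1) := by
    rw [value, expectedUtility_eq]
    refine (Finset.abs_sum_le_sum_abs _ _).trans (Finset.sum_le_sum fun ω _ => ?_)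
    have h₂ := abs_sum_payoff_lt (i := x.i) ω
    have h₃ : |jointProb (join πi (RatPartialProfile.toReal x.π)) ω| ≤ 1 := by
      rw [jointProb, Finset.abs_prod]
      refine Finset.prod_le_one (fun v _ => abs_nonneg _) fun v _ => ?_
      have := condProb_mem_Icc (join πi (RatPartialProfile.toReal x.π)) ω v
      rw [abs_of_nonneg this.1]
      exact this.2
    rw [abs_mul]
    calc _ ≤ 1 * |∑ v, payoff x.i v (ω v)| := by gcongr
      _ ≤ _ := by linarith
  have h₂ : ((Fintype.card x.M.Outcome : ℕ) : ℝ) ≤ 2 ^ x.M.enc.size := by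
    exact_mod_cast card_outcome_le
  have h₃ : (1 : ℝ) ≤ 2 ^ x.M.enc.size := one_le_pow₀ (by norm_num)
  rw [Finset.sum_const, nsmul_eq_mul, Finset.card_univ] at h₁
  have h₄ : (2 : ℝ) ^ x.M.enc.size * 2 ^ x.M.enc.size ≤ 2 ^ (2 * x.enc.size) := by
    rw [← pow_add]
    have := size_enc_le (x := x)
    exact pow_le_pow_right₀ (by norm_num) (by omega)
  nlinarith

theorem exists_optimal : ∃ F : x.M.PureRules, ∀ πi, x.value πi ≤ x.value (purePolicy x.i F) := by
  obtain ⟨F, hF⟩ := Finite.exists_max fun F : x.M.PureRules => x.value (purePolicy x.i F)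
  refine ⟨F, fun πi => ?_⟩
  obtain ⟨F', hF'⟩ := exists_purePolicy_le πi (RatPartialProfile.toReal x.π)
  exact hF'.trans (hF F')

variable (x) in
/-- The best expected utility. -/
noncomputable def optimum : ℝ := x.value (purePolicy x.i x.exists_optimal.choose)

theorem value_le_optimum (πi : x.M.Policy x.i) : x.value πi ≤ x.optimum :=
  x.exists_optimal.choose_spec πi

theorem question_iff_lt_optimum (q : Frac) :
    (IsBestResponseInput.mk x q).question ↔ q.toReal < x.optimum :=
  ⟨fun ⟨πi, h⟩ => h.trans_le (value_le_optimum πi), fun h => ⟨_, h⟩⟩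

theorem abs_optimum_lt : |x.optimum| < 2 ^ (2 * x.enc.size) := abs_value_lt _

/-- A pure policy that exceeds a sufficiently good lower bound of the optimum is optimal. -/
theorem isBestResponse_of_lt {F : x.M.PureRules} {q : ℝ} (hq : q < x.value (purePolicy x.i F))
    (hq' : x.optimum ≤ q + 1 / 2 ^ (2 * x.enc.size)) :
    IsBestResponse (purePolicy x.i F) (RatPartialProfile.toReal x.π) := by
  obtain ⟨D, hD₀, hD, h⟩ := exists_hasDenom_value (x := x)
  have hD₀' : (0 : ℝ) < D := by exact_mod_cast hD₀
  have hD' : (D : ℝ) ≤ 2 ^ (2 * x.enc.size) := by exact_mod_cast hD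
  have h₁ := value_le_optimum (purePolicy x.i F)
  have h₂ : (x.optimum - x.value (purePolicy x.i F)) * D < 1 := by
    have h₃ : x.optimum - x.value (purePolicy x.i F) < 1 / 2 ^ (2 * x.enc.size) := by linarith
    calc _ < 1 / 2 ^ (2 * x.enc.size) * (D : ℝ) := by gcongr
      _ ≤ 1 / 2 ^ (2 * x.enc.size) * 2 ^ (2 * x.enc.size) := by gcongr
      _ = 1 := by field_simp
  have h₃ := ((h _).sub (h F)).eq_zero (sub_nonneg.2 h₁) h₂
  have h₄ : x.optimum = x.value (purePolicy x.i F) := by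
    have := (mul_eq_zero.1 h₃).resolve_right hD₀'.ne'
    rw [← sub_eq_zero]
    exact this
  exact fun ϖ => (value_le_optimum ϖ).trans_eq h₄

end BestResponseInput


/-! ## Binary search -/

open Classical in
/-- The number `N / 2 ^ L`, or its negative if `σ` holds. -/
noncomputable def dyadic (σ : Prop) (N L : ℕ) : Frac :=
  ⟨if σ then -(N : ℤ) else N, 2 ^ L, by positivity⟩

open Classical in
theorem dyadic_toReal (σ : Prop) (N L : ℕ) :
    (dyadic σ N L).toReal = (if σ then -(N : ℝ) else N) / 2 ^ L := by
  unfold dyadic Frac.toReal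
  by_cases h : σ <;> simp [h]

-- The side condition excludes minus zero: the integer 0 is encoded without a sign.
open Classical in
theorem dyadic_enc {σ : Prop} {N : ℕ} (h : N ≠ 0 ∨ ¬ σ) (L : ℕ) :
    (dyadic σ N L).enc = .cons (.cons (if σ then .cons .nil .nil else .nil) (.binary N))
      (.binary (2 ^ L)) := by
  unfold dyadic Frac.enc Data.ofInt
  by_cases hσ : σ
  · have hN : 0 < N := Nat.pos_of_ne_zero (h.resolve_right (not_not.2 hσ))
    simp [hσ, hN, Data.ofBool]
  · simp [hσ, Data.ofBool, show ¬ (N : ℤ) < 0 by omega]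

open Classical in
/-- The leading bits of the absolute value of `V`, which is below `2 ^ L`. -/
noncomputable def searchBits (V : ℝ) (L : ℕ) : ℕ → ℕ
  | 0 => 0
  | n + 1 =>
    if (dyadic (V ≤ 0) (2 ^ (2 * L - n - 1) * (2 * searchBits V L n + 1)) L).toReal < V ↔ ¬ V ≤ 0
    then 2 * searchBits V L n + 1 else 2 * searchBits V L n

open Classical in
/-- The lower bound for `V` that is known after `n` steps of the binary search. -/
noncomputable def searchBound (V : ℝ) (L n : ℕ) : Frac :=
  dyadic (V ≤ 0) (2 ^ (2 * L - n) * (searchBits V L n + if V ≤ 0 then 1 else 0)) L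

theorem searchBits_lt (V : ℝ) (L n : ℕ) : searchBits V L n < 2 ^ n := by
  induction n with
  | zero => simp [searchBits]
  | succ n ih =>
    rw [searchBits, pow_succ]
    split <;> omega

-- Let b be the number found so far and δ = 2 ^ (2L - n) / 2 ^ L. A positive `V` is bounded below by
-- bδ, a nonpositive one by -(b + 1)δ. So for `V ≤ 0` the new bit is 1 exactly when the midpoint is
-- not below `V`. With either sign the bound moves to the midpoint if that is below `V`, and stays
-- otherwise.
open Classical in
theorem searchBound_succ {V : ℝ} {L n : ℕ} (hn : n < 2 * L) :
    searchBound V L (n + 1) =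
      if (dyadic (V ≤ 0) (2 ^ (2 * L - n - 1) * (2 * searchBits V L n + 1)) L).toReal < V
      then dyadic (V ≤ 0) (2 ^ (2 * L - n - 1) * (2 * searchBits V L n + 1)) L
      else searchBound V L n := by
  obtain ⟨j, hj⟩ : ∃ j, 2 * L - n = j + 1 := ⟨2 * L - n - 1, by omega⟩
  unfold searchBound
  rw [searchBits, ← Nat.sub_sub, hj, Nat.add_sub_cancel, pow_succ]
  by_cases h₂ : V ≤ 0 <;>
    by_cases h₃ : (dyadic (V ≤ 0) (2 ^ j * (2 * searchBits V L n + 1)) L).toReal < V <;>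
    simp only [h₂, not_true, not_false_eq_true, iff_true, iff_false, if_true, if_false] at h₃ ⊢ <;>
    simp only [h₃, not_true, not_false_eq_true, if_true, if_false] <;> congr 1 <;> ring

/-- The invariant is a half-open interval containing `V`, matching the strict inequality in the
question. Its length starts at 2 ^ L, the sign having selected the half-line, and is halved in every
round. -/
theorem searchBound_spec {V : ℝ} {L : ℕ} (hV : |V| < 2 ^ L) {n : ℕ} (hn : n ≤ 2 * L) :
    (searchBound V L n).toReal < V ∧
      V ≤ (searchBound V L n).toReal + 2 ^ (2 * L - n) / 2 ^ L := by
  have hV' := abs_lt.1 hV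
  have hp : (0 : ℝ) < 2 ^ L := by positivity
  induction n with
  | zero =>
    have h₂ : (2 : ℝ) ^ (2 * L) / 2 ^ L = 2 ^ L := by
      rw [two_mul, pow_add]
      field_simp
    unfold searchBound
    rw [dyadic_toReal]
    by_cases h : V ≤ 0
    · simp only [h, searchBits, if_true, Nat.sub_zero]
      push_cast
      rw [mul_one, neg_div, h₂]
      exact ⟨hV'.1, by linarith⟩
    · simp only [h, searchBits, if_false, Nat.sub_zero]
      push_cast
      simp only [mul_zero, zero_div, zero_add]
      rw [h₂]
      exact ⟨by linarith, hV'.2.le⟩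
  | succ n ih =>
    obtain ⟨ih₁, ih₂⟩ := ih (by omega)
    have h₁ : 2 * L - n = 2 * L - n - 1 + 1 := by omega
    have h₂ : (dyadic (V ≤ 0) (2 ^ (2 * L - n - 1) * (2 * searchBits V L n + 1)) L).toReal =
        (searchBound V L n).toReal + 2 ^ (2 * L - n - 1) / 2 ^ L := by
      unfold searchBound
      rw [dyadic_toReal, dyadic_toReal, h₁, pow_succ]
      simp only [Nat.add_sub_cancel]
      by_cases h : V ≤ 0
      · simp only [h, if_true]
        push_cast
        field_simp
        ring
      · simp only [h, if_false]
        push_cast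
        field_simp
        ring
    rw [searchBound_succ (by omega), ← Nat.sub_sub]
    rw [h₁, pow_succ] at ih₂
    split
    · refine ⟨‹_›, ?_⟩
      rw [h₂]
      calc V ≤ _ := ih₂
        _ = _ := by ring
    · refine ⟨ih₁, ?_⟩
      rw [← h₂]
      exact not_lt.1 ‹_›

theorem PolyTimeFun.searchBound_enc {α : Type} {i : α → Data} {V : α → ℝ} {L : α → ℕ}
    (hL : PolyTimeFun i fun a => .unary (L a))
    (oracle : PolyTimePred (fun b : α × Frac => .cons b.2.enc (i b.1))
      fun b => b.2.toReal < V b.1) :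
    PolyTimeFun i fun a => (searchBound (V a) (L a) (2 * L a)).enc := by
  classical
  have ask : ∀ {β : Type} {j : β → Data} (φ : β → α) (q : β → Frac),
      PolyTimeFun j (fun b => i (φ b)) → PolyTimeFun j (fun b => (q b).enc) →
        PolyTimePred j fun b => (q b).toReal < V (φ b) := fun φ q h₁ h₂ =>
    PolyTimePred.comp (h₂.cons h₁) (oracle.precomp fun b => (φ b, q b))
  have h2L : PolyTimeFun i fun a => .unary (2 * L a) :=
    (hL.unary_add hL).congr_fun fun a => by rw [two_mul]
  have hpow : PolyTimeFun i fun a => .binary (2 ^ L a) :=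
    (hL.binary_two_pow_mul (n := fun _ => 1) (const _) fun _ => one_ne_zero).congr_fun
      fun a => by rw [mul_one]
  -- The sign is settled by one question, with threshold 0.
  have hσ : PolyTimePred i fun a => V a ≤ 0 := by
    refine (ask (fun a => a) (fun _ => Frac.ofNat 0) id (const _)).not.congr fun a => ?_
    simp [Frac.toReal, Frac.ofNat]
  have hbits : ∀ a n, n ≤ 2 * L a →
      (Data.binary (searchBits (V a) (L a) n)).size ≤ 8 * L a + 1 := by
    intro a n hn
    have h₁ := Data.size_binary_le (searchBits (V a) (L a) n)
    have h₂ := Nat.size_le.2 (searchBits_lt (V a) (L a) n)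
    omega
  have hbound : ∀ a n, n ≤ 2 * L a →
      (searchBound (V a) (L a) n).enc.size ≤ 12 * L a + 20 := by
    intro a n hn
    have hN : 2 ^ (2 * L a - n) * (searchBits (V a) (L a) n + if V a ≤ 0 then 1 else 0) ≤
        2 ^ (2 * L a) := by
      have h₁ := searchBits_lt (V a) (L a) n
      calc _ ≤ 2 ^ (2 * L a - n) * 2 ^ n := by
            gcongr
            split <;> omega
        _ = _ := by rw [← pow_add]; congr 1; omega
    have hN₀ : 2 ^ (2 * L a - n) * (searchBits (V a) (L a) n + if V a ≤ 0 then 1 else 0) ≠ 0 ∨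
        ¬ V a ≤ 0 := by
      by_cases h : V a ≤ 0
      · left
        simp [h]
      · exact Or.inr h
    have h₂ := Data.size_binary_le
      (2 ^ (2 * L a - n) * (searchBits (V a) (L a) n + if V a ≤ 0 then 1 else 0))
    have h₃ := Nat.size_le.2 (hN.trans_lt (Nat.pow_lt_pow_right one_lt_two (Nat.lt_succ_self _)))
    have h₄ := Data.size_binary_le (2 ^ L a)
    rw [Nat.size_pow] at h₄
    have h₅ : (if V a ≤ 0 then Data.cons .nil .nil else .nil).size ≤ 3 := by
      split <;> simp [Data.size]
    rw [searchBound, dyadic_enc hN₀]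
    simp only [Data.size]
    omega
  -- The accumulator carries the current bound along with the bits. Computing the bound from the
  -- bits at the end would require a binary increment when `V ≤ 0`.
  refine (fold (l := fun a => List.replicate (2 * L a) .nil)
    (e := fun a => .cons (i a) (.cons (.binary (2 ^ L a)) (if V a ≤ 0 then .cons .nil .nil else .nil)))
    (acc := fun a n => .cons (.binary (searchBits (V a) (L a) n))
      (searchBound (V a) (L a) n).enc)
    h2L (id.cons (hpow.cons hσ)) ?_ ?_ ?_).snd.congr_fun fun a => by simp
  · refine (const (Data.binary 0)).cons (hσ.ite (p := fun a => V a ≤ 0)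
      (o₁ := fun a => .cons (.cons (.cons .nil .nil) (.binary (2 ^ (2 * L a)))) (.binary (2 ^ L a)))
      (o₂ := fun a => .cons (.cons .nil .nil) (.binary (2 ^ L a))) ?_ ?_) |>.congr_fun fun a => ?_
    · refine (PolyTimeFun.cons (const _) ?_).cons hpow
      exact (h2L.binary_two_pow_mul (n := fun _ => 1) (const _) fun _ => one_ne_zero).congr_fun
        fun a => by rw [mul_one]
    · exact (const _).cons hpow
    · rw [searchBound, dyadic_enc (by by_cases h : V a ≤ 0 <;> simp [h])]
      by_cases h : V a ≤ 0 <;> simp [h, searchBits, Data.binary, Data.ofList]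
  · refine ((hL.polyBdd.precomp _).mul (PolyBdd.const 20)).add (PolyBdd.const 30)
      |>.of_le fun b => ?_
    have hn : b.1.2 ≤ 2 * L b.1.1 := by simpa using b.2
    have h₁ := hbits b.1.1 b.1.2 hn
    have h₂ := hbound b.1.1 b.1.2 hn
    simp only [Data.size, Data.size_unary]
    omega
  · have hlt : ∀ b : {b : α × ℕ // b.2 < (List.replicate (2 * L b.1) Data.nil).length},
        b.1.2 < 2 * L b.1.1 := fun b => by simpa using b.2
    intro I _ hrest henv hacc
    -- The unread part of the loop counter is exactly the exponent in the next midpoint.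
    have hj : PolyTimeFun I fun b => .unary (2 * L b.1.1 - b.1.2 - 1) :=
      hrest.congr_fun fun b => by rw [List.drop_replicate, ← Nat.sub_sub]; rfl
    have hN := hj.binary_two_pow_mul
      (n := fun b => 2 * searchBits (V b.1.1) (L b.1.1) b.1.2 + 1)
      (((const (.cons .nil .nil)).cons hacc.fst).congr_fun fun b =>
        (Data.binary_two_mul_add_one _).symm) fun b => by omega
    have hq := ((henv.snd.snd.cons hN).cons henv.snd.fst).congr_fun
      (o' := fun b => (dyadic (V b.1.1 ≤ 0) (2 ^ (2 * L b.1.1 - b.1.2 - 1) *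
        (2 * searchBits (V b.1.1) (L b.1.1) b.1.2 + 1)) (L b.1.1)).enc) fun b =>
          (dyadic_enc (Or.inl (by positivity)) _).symm
    have hyes := ask (β := {b : α × ℕ // b.2 < (List.replicate (2 * L b.1) Data.nil).length})
      (fun b => b.1.1) (fun b => dyadic (V b.1.1 ≤ 0)
      (2 ^ (2 * L b.1.1 - b.1.2 - 1) * (2 * searchBits (V b.1.1) (L b.1.1) b.1.2 + 1)) (L b.1.1))
      henv.fst hq
    have hs : PolyTimePred I fun b => V b.1.1 ≤ 0 := henv.snd.snd
    -- Appending a zero bit must leave the notation of zero empty, hence the test for `nil`.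
    refine ((hyes.iff hs.not).ite ((const (.cons .nil .nil)).cons hacc.fst)
      ((PolyTimePred.isNil hacc.fst).ite nil (nil.cons hacc.fst))).cons
      (hyes.ite hq hacc.snd) |>.congr_fun fun b => ?_
    rw [searchBound_succ (hlt b), searchBits]
    congr 1
    · split
      · rw [Data.binary_two_mul_add_one]
      · by_cases h0 : searchBits (V b.1.1) (L b.1.1) b.1.2 = 0
        · simp [h0, Data.binary, Data.ofList]
        · rw [if_neg (mt Data.binary_eq_nil.1 h0), Data.binary_two_mul h0]
    · split <;> rfl


/-! ## Encodings of instances with fixed decisions -/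

namespace Diagram

variable {G : Diagram} {v : Fin G.numVars}

/-- The table of a pure decision rule. -/
def ruleEnc (f : G.Ctx v → Fin (G.dom v)) : Data :=
  encTable RatDist.enc fun c => RatDist.pure (f c)

/-- The number of contexts of a variable. -/
def numCtx (G : Diagram) (v : Fin G.numVars) : ℕ := ((G.parents v).map G.dom).prod

theorem prod_dom_eq : ∏ p : Fin (G.parents v).length, G.dom ((G.parents v).get p) =
    G.numCtx v := by
  rw [numCtx, ← List.prod_ofFn]
  congr 1
  refine List.ext_getElem (by simp) fun n h₁ h₂ => by simp

theorem numCtx_pos : 0 < G.numCtx v :=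
  List.prod_pos fun n hn => by
    obtain ⟨u, -, rfl⟩ := List.mem_map.1 hn
    have := G.two_le_dom u
    omega

/-- The tables of pure decision rules for `n` contexts and `d` values. -/
noncomputable def pureTables (d n : ℕ) : List Data :=
  (Finset.univ : Finset (Fin n → Fin d)).toList.map fun g =>
    .ofList (List.ofFn fun r => (RatDist.pure (g r)).enc)

variable (G v) in
/-- The list of all pure decision rules. -/
noncomputable def pureRuleList : List (G.Ctx v → Fin (G.dom v)) :=
  (Finset.univ : Finset (Fin (∏ p : Fin (G.parents v).length, G.dom ((G.parents v).get p)) →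
    Fin (G.dom v))).toList.map fun g c => g (finPiFinEquiv c)

theorem mem_pureRuleList (f : G.Ctx v → Fin (G.dom v)) : f ∈ G.pureRuleList v :=
  List.mem_map.2 ⟨fun r => f (finPiFinEquiv.symm r), by simp, by simp⟩

/-- The list of tables depends only on the number of values and the number of contexts. This is what
makes a finite lookup possible, although the enumeration itself is an arbitrary choice. -/
theorem map_ruleEnc_pureRuleList :
    (G.pureRuleList v).map ruleEnc = pureTables (G.dom v) (G.numCtx v) := by
  rw [← prod_dom_eq, pureRuleList, pureTables, List.map_map]
  refine List.map_congr_left fun g _ => ?_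
  simp only [Function.comp_apply, ruleEnc, encTable, Equiv.apply_symm_apply]

/-- In the search for a rule, `nil` stands for "none found yet" and must differ from every table. -/
theorem ruleEnc_ne_nil (f : G.Ctx v → Fin (G.dom v)) : ruleEnc f ≠ .nil := by
  have := (prod_dom_eq (v := v)).trans_gt (numCtx_pos (v := v))
  rw [ruleEnc, encTable, Ne, Data.ofList_eq_nil, ← List.length_eq_zero_iff, List.length_ofFn]
  omega

theorem size_ruleEnc_le {k b : ℕ} (hk : (G.parents v).length ≤ k) (hb : G.dom v ≤ b)
    (hp : ∀ u ∈ G.parents v, G.dom u ≤ b) (f : G.Ctx v → Fin (G.dom v)) :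
    (ruleEnc f).size ≤ (b + 1) ^ k * (b * 14 + 2) + 1 := by
  -- Pure rules contain only the fractions 0 and 1; the encoding of 1 has 13 nodes.
  have hfrac : ∀ n ≤ 1, (Frac.ofNat n).enc.size ≤ 13 := by
    intro n hn
    interval_cases n <;>
      simp [Frac.ofNat, Frac.enc, Data.ofInt, Data.ofBool, Data.binary, Data.ofList, Data.size]
  have hdist : ∀ y : Fin (G.dom v), (RatDist.pure y).enc.size ≤ b * 14 + 1 := by
    intro y
    refine (Data.size_ofList_le_of_forall (B := 13) fun d hd => ?_).trans ?_
    · obtain ⟨e, rfl⟩ := List.mem_ofFn.1 hd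
      exact hfrac _ (by split <;> omega)
    · rw [List.length_ofFn]
      omega
  -- The base `b + 1` is positive even for `b = 0`, so the power is monotone in the exponent.
  have hctx : G.numCtx v ≤ (b + 1) ^ k := by
    refine (List.prod_le_pow_card _ (b + 1) fun n hn => ?_).trans
      (Nat.pow_le_pow_right (by omega) (by simpa using hk))
    obtain ⟨u, hu, rfl⟩ := List.mem_map.1 hn
    have := hp u hu
    omega
  refine (Data.size_ofList_le_of_forall (B := b * 14 + 1) fun d hd => ?_).trans ?_
  · obtain ⟨e, rfl⟩ := List.mem_ofFn.1 hd
    exact hdist _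
  · rw [List.length_ofFn, prod_dom_eq]
    gcongr

end Diagram

namespace BestResponseInput

open MAID Diagram

variable (x : BestResponseInput)

/-- The description of a decision that follows the pure rule with the given table. -/
def fixedVarEnc (v : Fin x.M.numVars) (T : Data) : Data :=
  .ofList [.unary (x.M.dom v), .ofList ((x.M.parents v).map fun u : Fin x.M.numVars => Data.unary u.1),
    .ofList [.unary 0, T]]

open Classical in
/-- The description of a variable when all decisions of the agent follow the pure rules `F`. -/
noncomputable def fixVarEnc (F : x.M.PureRules) (v : Fin x.M.numVars) : Data :=
  if x.M.node v = .decision x.i then x.fixedVarEnc v (ruleEnc (F v)) else x.M.varEnc v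

open Classical in
/-- The entry for a variable in the description of the policy that follows the pure rules `F`. -/
noncomputable def outEnc (F : x.M.PureRules) (v : Fin x.M.numVars) : Data :=
  if x.M.node v = .decision x.i then ruleEnc (F v) else .nil

variable {x}

theorem varEnc_fixBelow_of_lt {F : x.M.PureRules} {n : ℕ} {v : Fin x.M.numVars} (hv : v.1 < n) :
    (x.fixBelow F n).M.varEnc v = x.fixVarEnc F v := by
  unfold fixVarEnc varEnc
  by_cases h : x.M.node v = .decision x.i
  · rw [if_pos h, node_fixBelow F n ⟨hv, h⟩]
    rfl
  · rw [if_neg h, node_fixBelow_of_not F n fun h' => h h'.2]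

theorem varEnc_fixBelow_of_le {F : x.M.PureRules} {n : ℕ} {v : Fin x.M.numVars} (hv : n ≤ v.1) :
    (x.fixBelow F n).M.varEnc v = x.M.varEnc v := by
  unfold varEnc
  rw [node_fixBelow_of_not F n fun h => absurd h.1 (not_lt.2 hv)]

theorem policyEnc_fixBelow (F : x.M.PureRules) (n : ℕ) :
    RatPartialProfile.enc (x.fixBelow F n).π = RatPartialProfile.enc x.π := by
  unfold RatPartialProfile.enc
  congr 2
  funext j
  by_cases hj : j = x.i
  · simp [hj]
  · have hj' : ¬ j = (x.fixBelow F n).i := hj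
    rw [dif_neg hj, dif_neg hj']
    unfold RatPolicy.enc
    congr 2
    funext v
    by_cases h : x.M.node v = .decision j
    · have h' : (x.fixBelow F n).M.node v = .decision j :=
        (node_fixBelow_of_not F n fun h' => hj (by
          have := h.symm.trans h'.2
          simpa using this)).trans h
      rw [dif_pos h, dif_pos h']
    · have h' : ¬ (x.fixBelow F n).M.node v = .decision j := fun h' =>
        h (node_of_node_fixBelow h')
      rw [dif_neg h, dif_neg h']

theorem enc_eq : x.enc = .ofList [.cons (.unary x.M.numAgents) (.ofList (List.ofFn x.M.varEnc)),
    .unary x.i, RatPartialProfile.enc x.π] := by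
  rw [← MAID.enc_eq]
  rfl

/-- The three segments are what the loop over the variables has at hand: entries already rewritten,
the entry under trial, and unread input. A query is assembled by list operations alone. -/
theorem enc_fixBelow_update (F : x.M.PureRules) (v : Fin x.M.numVars)
    (hv : x.M.node v = .decision x.i) (f : x.M.Ctx v → Fin (x.M.dom v)) :
    (x.fixBelow (Function.update F v f) (v.1 + 1)).enc =
      .ofList [.cons (.unary x.M.numAgents) (.ofList (((List.ofFn (x.fixVarEnc F)).take v.1) ++
        x.fixedVarEnc v (ruleEnc f) :: (List.ofFn x.M.varEnc).drop (v.1 + 1))),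
        .unary x.i, RatPartialProfile.enc x.π] := by
  rw [enc_eq, policyEnc_fixBelow]
  congr 4
  refine List.ext_getElem (by simp; omega) fun n h₁ h₂ => ?_
  have hn : n < x.M.numVars := by simpa using h₁
  rw [List.getElem_ofFn]
  rcases lt_trichotomy n v.1 with h | h | h
  · rw [List.getElem_append_left (by simp; omega), List.getElem_take, List.getElem_ofFn,
      varEnc_fixBelow_of_lt (by simp only; omega)]
    unfold fixVarEnc
    rw [Function.update_of_ne (fun h' => by
      have := congrArg Fin.val h'
      simp only at this
      omega)]
  · subst h
    rw [List.getElem_append_right (by simp)]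
    rw [varEnc_fixBelow_of_lt (by simp)]
    unfold fixVarEnc
    rw [if_pos hv]
    simp
  · rw [List.getElem_append_right (by simp; omega), varEnc_fixBelow_of_le (by simp only; omega)]
    simp only [List.length_take, List.length_ofFn]
    rw [List.getElem_cons, dif_neg (by omega), List.getElem_drop, List.getElem_ofFn]
    congr 2
    omega

/-! ## Greedy choice of the decision rules -/

open Classical in
variable (x) in
/-- The first pure rule for `v` that keeps the best expected utility above `q`, when the decisions
before `v` follow `F`. -/
noncomputable def firstRule (q : Frac) (F : x.M.PureRules) (v : Fin x.M.numVars) :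
    Option (x.M.Ctx v → Fin (x.M.dom v)) :=
  (x.M.pureRuleList v).find? fun f =>
    (IsBestResponseInput.mk (x.fixBelow (Function.update F v f) (v.1 + 1)) q).question

theorem question_fixBelow_congr {F F' : x.M.PureRules} {n : ℕ} (h : ∀ v, v.1 < n → F v = F' v)
    (q : Frac) : (IsBestResponseInput.mk (x.fixBelow F n) q).question ↔
      (IsBestResponseInput.mk (x.fixBelow F' n) q).question := by
  have : ∀ πi : x.M.Policy x.i, mixPolicy F n πi = mixPolicy F' n πi := by
    intro πi
    funext v hv
    by_cases hn : v.1 < n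
    · rw [mixPolicy_of_lt _ _ hn, mixPolicy_of_lt _ _ hn, h v hn]
    · rw [mixPolicy_of_le _ _ (not_lt.1 hn), mixPolicy_of_le _ _ (not_lt.1 hn)]
  simp only [question_fixBelow_iff, this]

/-- The choice at `v` depends only on earlier choices, which permits the recursive definition of all
choices. -/
theorem firstRule_congr {F F' : x.M.PureRules} {v : Fin x.M.numVars}
    (h : ∀ w, w < v → F w = F' w) (q : Frac) : x.firstRule q F v = x.firstRule q F' v := by
  unfold firstRule
  congr 1
  funext f
  congr 1
  refine propext (question_fixBelow_congr (fun w hw => ?_) q)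
  by_cases hwv : w = v
  · subst hwv
    simp
  · rw [Function.update_of_ne hwv, Function.update_of_ne hwv]
    exact h w (lt_of_le_of_ne (Fin.le_def.2 (by omega)) hwv)

theorem exists_greedy (x : BestResponseInput) (q : Frac) : ∃ F : x.M.PureRules,
    ∀ v f, x.firstRule q F v = some f → F v = f := by
  let F₀ : x.M.PureRules := Classical.arbitrary _
  let step : (v : Fin x.M.numVars) → ((w : Fin x.M.numVars) → w < v →
      x.M.Ctx w → Fin (x.M.dom w)) → x.M.Ctx v → Fin (x.M.dom v) :=
    -- The values of `F₀` at later variables have no influence. The default at `v` itself matters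
    -- only if no rule passes, which `question_greedy` excludes at the agent's decisions when the
    -- initial question has a positive answer.
    fun v ih => (x.firstRule q (fun w => if h : w < v then ih w h else F₀ w) v).getD (F₀ v)
  refine ⟨(wellFounded_lt (α := Fin x.M.numVars)).fix step, fun v f hf => ?_⟩
  rw [WellFounded.fix_eq]
  change (x.firstRule q _ v).getD _ = f
  rw [firstRule_congr (F' := (wellFounded_lt (α := Fin x.M.numVars)).fix step)
    (fun w hw => dif_pos hw), hf, Option.getD_some]

/-- Pure rules that are chosen one after the other. -/
noncomputable def greedy (x : BestResponseInput) (q : Frac) : x.M.PureRules :=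
  (x.exists_greedy q).choose

/-- Invariant of the self-reduction: some policy that follows the chosen rules below `n` still
exceeds `q`, so the search at the next decision succeeds. -/
theorem question_greedy {q : Frac} (h : (IsBestResponseInput.mk x q).question) {n : ℕ}
    (hn : n ≤ x.M.numVars) :
    (IsBestResponseInput.mk (x.fixBelow (x.greedy q) n) q).question ∧
      ∀ v, v.1 < n → x.M.node v = .decision x.i →
        x.firstRule q (x.greedy q) v = some (x.greedy q v) := by
  induction n with
  | zero =>
    refine ⟨?_, fun v hv => absurd hv (Nat.not_lt_zero _)⟩
    obtain ⟨πi, hπ⟩ := h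
    exact (question_fixBelow_iff _ _ q).2 ⟨πi, by rwa [mixPolicy_zero]⟩
  | succ n ih =>
    obtain ⟨ih₁, ih₂⟩ := ih (by omega)
    let v : Fin x.M.numVars := ⟨n, hn⟩
    have hlast : ∀ w : Fin x.M.numVars, w.1 < n + 1 → w.1 < n ∨ w = v := fun w hw =>
      (Nat.lt_succ_iff_lt_or_eq.1 hw).imp_right Fin.ext
    by_cases hv : x.M.node v = .decision x.i
    · obtain ⟨f, hf⟩ := question_fixBelow_succ (v := v) hv ih₁
      obtain ⟨g, hg⟩ : ∃ g, x.firstRule q (x.greedy q) v = some g := by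
        rw [← Option.isSome_iff_exists, firstRule, List.find?_isSome]
        exact ⟨f, mem_pureRuleList f, by simpa using hf⟩
      have hvg := (x.exists_greedy q).choose_spec v g hg
      have hq := List.find?_some hg
      rw [← hvg] at hq hg
      refine ⟨?_, fun w hw hdec => ?_⟩
      · simp only [decide_eq_true_eq] at hq
        rwa [show Function.update (x.greedy q) v ((x.exists_greedy q).choose v) = x.greedy q from
          Function.update_eq_self _ _] at hq
      · rcases hlast w hw with h | rfl
        · exact ih₂ w h hdec
        · exact hg
    · refine ⟨question_fixBelow_succ_of_ne (v := v) hv ih₁, fun w hw hdec => ?_⟩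
      rcases hlast w hw with h | rfl
      · exact ih₂ w h hdec
      · exact absurd hdec hv

theorem lt_value_greedy {q : Frac} (h : (IsBestResponseInput.mk x q).question) :
    q.toReal < x.value (purePolicy x.i (x.greedy q)) := by
  obtain ⟨πi, hπ⟩ := (question_fixBelow_iff _ _ q).1 (question_greedy h le_rfl).1
  rwa [mixPolicy_numVars] at hπ

end BestResponseInput


/-! ## The algorithm -/

namespace Diagram.Node

variable {G : Diagram} {v : Fin G.numVars}

/-- The agent who makes a decision. -/
def agentIndex : G.Node v → ℕ
  | .decision l => l
  | _ => 0

theorem head_enc_eq_iff {N : G.Node v} : N.enc.head = .unary 1 ↔ ∃ l, N = .decision l := by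
  cases N with
  | chance c =>
    exact iff_of_false (fun h => absurd (Data.unary_injective h) (by decide)) (by simp)
  | decision l => exact ⟨fun _ => ⟨l, rfl⟩, fun _ => rfl⟩
  | utility l u o =>
    exact iff_of_false (fun h => absurd (Data.unary_injective h) (by decide)) (by simp)

open Classical in
theorem ite_enc_eq (N : G.Node v) :
    (if N.enc.head = .unary 1 then N.enc.tail.head else .nil) = .unary N.agentIndex := by
  by_cases h : N.enc.head = .unary 1
  · obtain ⟨l, rfl⟩ := head_enc_eq_iff.1 h
    exact if_pos h
  · rw [if_neg h]
    cases N with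
    | decision l => exact absurd rfl h
    | chance c => rfl
    | utility l u o => rfl

theorem eq_decision_iff {N : G.Node v} {i : Fin G.numAgents} :
    N = .decision i ↔ N.enc.head = .unary 1 ∧ N.agentIndex = i := by
  rw [head_enc_eq_iff]
  constructor
  · rintro rfl
    exact ⟨⟨i, rfl⟩, rfl⟩
  · rintro ⟨⟨l, rfl⟩, h⟩
    rw [Fin.ext (a := l) (b := i) h]

end Diagram.Node

namespace BestResponseInput

open MAID Diagram

variable {β : Type} {j : β → Data} {x : β → BestResponseInput}
  {v : (a : β) → Fin (x a).M.numVars}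

theorem polyTimePred_isDecision (hv : PolyTimeFun j fun a => (x a).M.varEnc (v a))
    (hi : PolyTimeFun j fun a => .unary (x a).i) :
    PolyTimePred j fun a => (x a).M.node (v a) = .decision (x a).i := by
  classical
  have htag := PolyTimePred.eq_const hv.tail.tail.head.head (.unary 1)
  have hagent : PolyTimeFun j fun a => .unary ((x a).M.node (v a)).agentIndex :=
    (htag.ite hv.tail.tail.head.tail.head PolyTimeFun.nil).congr_fun fun a =>
      Node.ite_enc_eq _
  exact (htag.and (PolyTimePred.unary_eq hagent hi)).congr fun a => Node.eq_decision_iff.symm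

theorem polyTimeFun_parentDoms (hv : PolyTimeFun j fun a => (x a).M.varEnc (v a))
    (hvars : PolyTimeFun j fun a => .ofList (List.ofFn (x a).M.varEnc)) :
    PolyTimeFun j fun a => .ofList (((x a).M.parents (v a)).map fun u => .unary ((x a).M.dom u)) := by
  refine (PolyTimeFun.map (l := fun a => ((x a).M.parents (v a)).map fun u : Fin (x a).M.numVars => Data.unary u.1)
    -- The expression `(d.size - 1) / 2` recovers a number from its unary notation. Dropping that
    -- many variable entries brings the parent to the front, where its domain is read.
    (g := fun a d => (Data.ofList ((List.ofFn (x a).M.varEnc).drop ((d.size - 1) / 2))).head.head)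
    hv.tail.head hvars fun I hd he => ?_).congr_fun fun a => ?_
  · refine (PolyTimeFun.drop he (hd.congr_fun fun b => ?_)).head.head
    obtain ⟨u, -, hu⟩ := List.mem_map.1 b.2
    rw [← hu, Data.size_unary]
    congr 1
    omega
  · rw [List.map_map]
    congr 1
    refine List.map_congr_left fun u _ => ?_
    rw [Function.comp_apply, Data.size_unary, show (2 * u.1 + 1 - 1) / 2 = u.1 by omega,
      List.drop_eq_getElem_cons (by simp), List.getElem_ofFn]
    rfl

/-- The list of tables is determined by the domain of the decision and those of its parents. The
bounds `k` and `b` leave only finitely many such keys, so a hard-wired table suffices. -/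
theorem polyTimeFun_pureRuleList {k b : ℕ}
    (hbdd : ∀ a, (x a).M.BoundedDecisions (x a).i k b)
    (hdec : ∀ a, (x a).M.node (v a) = .decision (x a).i)
    (hv : PolyTimeFun j fun a => (x a).M.varEnc (v a))
    (hvars : PolyTimeFun j fun a => .ofList (List.ofFn (x a).M.varEnc)) :
    PolyTimeFun j fun a => .ofList (((x a).M.pureRuleList (v a)).map ruleEnc) := by
  refine (hv.head.cons (polyTimeFun_parentDoms hv hvars)).comp (PolyTimeFun.of_finite ?_ ?_)
  · refine (Data.finite_size_le (2 * b + 1 + (k * (2 * b + 1 + 1) + 1) + 1)).subset ?_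
    rintro _ ⟨a, rfl⟩
    obtain ⟨h₁, h₂, h₃⟩ := hbdd a _ (hdec a)
    have h₄ : (Data.ofList (((x a).M.parents (v a)).map fun u =>
        .unary ((x a).M.dom u))).size ≤ k * (2 * b + 1 + 1) + 1 := by
      refine (Data.size_ofList_le_of_forall (B := 2 * b + 1) fun d hd => ?_).trans ?_
      · obtain ⟨u, hu, rfl⟩ := List.mem_map.1 hd
        have := h₃ u hu
        rw [Data.size_unary]
        omega
      · rw [List.length_map]
        gcongr
    simp only [Set.mem_ofPred_eq, Data.size, varEnc, Data.ofList, Data.head, Data.size_unary]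
    omega
  · intro a a' h
    simp only [varEnc, Data.ofList, Data.head, Data.cons.injEq] at h
    obtain ⟨h₁, h₂⟩ := h
    have h₃ := congrArg (List.map Data.size) (Data.ofList_injective h₂)
    rw [List.map_map, List.map_map] at h₃
    have h₄ := congrArg (List.map fun n => (n - 1) / 2) h₃
    rw [List.map_map, List.map_map] at h₄
    have h₅ : ∀ a, ((x a).M.parents (v a)).map ((fun n => (n - 1) / 2) ∘
        (Data.size ∘ fun u => Data.unary ((x a).M.dom u))) =
          ((x a).M.parents (v a)).map (x a).M.dom := fun a => by
      refine List.map_congr_left fun u _ => ?_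
      simp only [Function.comp_apply, Data.size_unary]
      omega
    rw [h₅, h₅] at h₄
    rw [map_ruleEnc_pureRuleList, map_ruleEnc_pureRuleList, Data.unary_injective h₁, numCtx,
      numCtx, h₄]

/-- With a program for Is-Best-Response, the next decision rule can be found by trying all pure
rules. -/
theorem polyTimeFun_greedy {valid : BestResponseInput → Prop} {k b : ℕ}
    (hfix : ∀ x : BestResponseInput, valid x → ∀ F n, valid (x.fixBelow F n))
    (hbdd : ∀ x : BestResponseInput, valid x → x.M.BoundedDecisions x.i k b)
    (oracle : PolyTimePred
      (fun y : {y : IsBestResponseInput // valid y.toBestResponseInput} => y.1.enc)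
      fun y => y.1.question)
    (hvalid : ∀ a, valid (x a))
    (hdec : ∀ a, (x a).M.node (v a) = .decision (x a).i)
    {q : β → Frac} (hqq : ∀ a, (IsBestResponseInput.mk (x a) (q a)).question)
    (hq : PolyTimeFun j fun a => (q a).enc) (hx : PolyTimeFun j fun a => (x a).enc)
    (hv : PolyTimeFun j fun a => (x a).M.varEnc (v a))
    (hdone : PolyTimeFun j fun a =>
      .ofList ((List.ofFn ((x a).fixVarEnc ((x a).greedy (q a)))).take (v a).1).reverse)
    (hrest : PolyTimeFun j fun a => .ofList ((List.ofFn (x a).M.varEnc).drop ((v a).1 + 1))) :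
    PolyTimeFun j fun a => ruleEnc ((x a).greedy (q a) (v a)) := by
  classical
  have hvars := (hx.congr_fun fun a => enc_eq).fst.snd
  have hl := polyTimeFun_pureRuleList (fun a => hbdd _ (hvalid a)) hdec hv hvars
  let good : (a : β) → ((x a).M.Ctx (v a) → Fin ((x a).M.dom (v a))) → Bool := fun a f =>
    decide (IsBestResponseInput.mk ((x a).fixBelow (Function.update ((x a).greedy (q a)) (v a) f)
      ((v a).1 + 1)) (q a)).question
  refine (PolyTimeFun.fold (l := fun a => ((x a).M.pureRuleList (v a)).map ruleEnc)
    (e := fun a => .cons (q a).enc (.cons (x a).enc (.cons ((x a).M.varEnc (v a)) (.cons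
      (.ofList ((List.ofFn ((x a).fixVarEnc ((x a).greedy (q a)))).take (v a).1).reverse)
      (.ofList ((List.ofFn (x a).M.varEnc).drop ((v a).1 + 1)))))))
    -- The accumulator is the first successful rule among the candidates tried, or `nil`; the oracle
    -- is asked only while it is `nil`.
    (acc := fun a n => ((((x a).M.pureRuleList (v a)).take n).find? (good a)).elim .nil ruleEnc)
    hl (hq.cons (hx.cons (hv.cons (hdone.cons hrest)))) ?_ ?_ ?_).congr_fun fun a => ?_
  · exact PolyTimeFun.nil.congr_fun fun a => by simp
  · refine ((hl.polyBdd.precomp _).add (PolyBdd.const 1)).of_le fun b => ?_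
    cases h : (((x b.1.1).M.pureRuleList (v b.1.1)).take b.1.2).find? (good b.1.1) with
    | none => simp [Data.size]
    | some f =>
      have := List.mem_of_mem_take (List.mem_of_find?_eq_some h)
      exact (Data.size_le_of_mem (List.mem_map_of_mem (f := ruleEnc) this)).le.trans
        (Nat.le_succ _)
  · intro I hT _ he hacc
    have hlen : ∀ b : {b : β × ℕ // b.2 < (((x b.1).M.pureRuleList (v b.1)).map ruleEnc).length},
        b.1.2 < ((x b.1.1).M.pureRuleList (v b.1.1)).length := fun b => by
      have := b.2
      rwa [List.length_map] at this
    replace hT : PolyTimeFun I fun b =>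
        ruleEnc (((x b.1.1).M.pureRuleList (v b.1.1))[b.1.2]'(hlen b)) :=
      hT.congr_fun fun b => by rw [List.getElem_map]
    have hentry : PolyTimeFun I fun b => (x b.1.1).fixedVarEnc (v b.1.1)
        (ruleEnc (((x b.1.1).M.pureRuleList (v b.1.1))[b.1.2]'(hlen b))) :=
      he.snd.snd.fst.head.cons (he.snd.snd.fst.tail.head.cons
        ((PolyTimeFun.nil.cons (hT.cons .nil)).cons .nil))
    have hquery : PolyTimeFun I fun b => (IsBestResponseInput.mk ((x b.1.1).fixBelow
        (Function.update ((x b.1.1).greedy (q b.1.1)) (v b.1.1)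
          (((x b.1.1).M.pureRuleList (v b.1.1))[b.1.2]'(hlen b))) ((v b.1.1).1 + 1))
            (q b.1.1)).enc := by
      refine he.fst.cons (((he.snd.fst.head.head.cons
        (PolyTimeFun.reverse_append
          (l₂ := fun b => (x b.1.1).fixedVarEnc (v b.1.1)
            (ruleEnc (((x b.1.1).M.pureRuleList (v b.1.1))[b.1.2]'(hlen b))) ::
              (List.ofFn (x b.1.1).M.varEnc).drop ((v b.1.1).1 + 1))
          he.snd.snd.snd.fst (hentry.cons he.snd.snd.snd.snd))).cons he.snd.fst.tail).congr_fun
        fun b => ?_)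
      rw [enc_fixBelow_update _ _ (hdec b.1.1), List.reverse_reverse]
      rfl
    have hask := PolyTimePred.comp hquery (oracle.precomp fun b :
      {b : β × ℕ // b.2 < (((x b.1).M.pureRuleList (v b.1)).map ruleEnc).length} =>
        ⟨IsBestResponseInput.mk ((x b.1.1).fixBelow
        (Function.update ((x b.1.1).greedy (q b.1.1)) (v b.1.1)
          (((x b.1.1).M.pureRuleList (v b.1.1))[b.1.2]'(hlen b))) ((v b.1.1).1 + 1))
            (q b.1.1), hfix _ (hvalid b.1.1) _ _⟩)
    refine ((PolyTimePred.isNil hacc).ite (hask.ite hT PolyTimeFun.nil) hacc).congr_fun fun b => ?_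
    rw [← List.take_concat_get' _ _ (hlen b), List.find?_append]
    cases (((x b.1.1).M.pureRuleList (v b.1.1)).take b.1.2).find? (good b.1.1) with
    | none =>
      by_cases hg : (IsBestResponseInput.mk ((x b.1.1).fixBelow
        (Function.update ((x b.1.1).greedy (q b.1.1)) (v b.1.1)
          (((x b.1.1).M.pureRuleList (v b.1.1))[b.1.2]'(hlen b))) ((v b.1.1).1 + 1))
            (q b.1.1)).question <;> simp [good, hg]
    | some f => simp [ruleEnc_ne_nil]
  · have h := (question_greedy (hqq a) le_rfl).2 (v a) (v a).2 (hdec a)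
    rw [List.length_map, List.take_length]
    change (firstRule _ _ _ _).elim _ _ = _
    rw [h]
    rfl

/-- One pass over the variables builds two reversed lists: the rewritten entries, from which later
queries are formed, and the output. Neither list blows up, because the size of a pure table is
bounded in terms of `k` and `b`. -/
theorem polyTimeFun_policy {valid : BestResponseInput → Prop} {k b : ℕ}
    (hfix : ∀ x : BestResponseInput, valid x → ∀ F n, valid (x.fixBelow F n))
    (hbdd : ∀ x : BestResponseInput, valid x → x.M.BoundedDecisions x.i k b)
    (oracle : PolyTimePred
      (fun y : {y : IsBestResponseInput // valid y.toBestResponseInput} => y.1.enc)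
      fun y => y.1.question)
    (hvalid : ∀ a, valid (x a))
    {q : β → Frac} (hqq : ∀ a, (IsBestResponseInput.mk (x a) (q a)).question)
    (hq : PolyTimeFun j fun a => (q a).enc) (hx : PolyTimeFun j fun a => (x a).enc) :
    PolyTimeFun j fun a => .ofList (List.ofFn ((x a).outEnc ((x a).greedy (q a)))) := by
  classical
  refine (PolyTimeFun.fold (l := fun a => List.ofFn (x a).M.varEnc)
    (e := fun a => .cons (q a).enc (x a).enc)
    (acc := fun a n => .cons
      (.ofList ((List.ofFn ((x a).fixVarEnc ((x a).greedy (q a)))).take n).reverse)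
      (.ofList ((List.ofFn ((x a).outEnc ((x a).greedy (q a)))).take n).reverse))
    (hx.congr_fun fun a => enc_eq).fst.snd (hq.cons hx) ?_ ?_ ?_).snd.reverse.congr_fun fun a => by
      rw [List.reverse_reverse, List.length_ofFn, List.take_of_length_le (by simp)]
  · exact (PolyTimeFun.const (.cons .nil .nil)).congr_fun fun a => by simp [Data.ofList]
  · obtain ⟨C, hC⟩ : ∃ C, C = (b + 1) ^ k * (b * 14 + 2) + 1 := ⟨_, rfl⟩
    have hsize := hx.polyBdd.precomp
      (fun c : {c : β × ℕ // c.2 ≤ (List.ofFn (x c.1).M.varEnc).length} => c.1.1)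
    refine (((hsize.mul ((hsize.add (PolyBdd.const (C + 10))).add (PolyBdd.const 1))).mul
      (PolyBdd.const 2)).add (PolyBdd.const 3)).of_le fun c => ?_
    have hlist : (Data.ofList (List.ofFn (x c.1.1).M.varEnc)).size ≤ (x c.1.1).enc.size := by
      rw [enc_eq]
      simp only [Data.ofList, Data.size]
      omega
    have hn : c.1.2 ≤ (x c.1.1).enc.size :=
      (c.2.trans (Data.length_lt_size_ofList _).le).trans hlist
    have hrule : ∀ w, (x c.1.1).M.node w = .decision (x c.1.1).i →
        (ruleEnc ((x c.1.1).greedy (q c.1.1) w)).size ≤ C := fun w hw => by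
      obtain ⟨h₁, h₂, h₃⟩ := hbdd _ (hvalid c.1.1) w hw
      exact hC ▸ size_ruleEnc_le h₁ h₂ h₃ _
    have hvar : ∀ w, ((x c.1.1).M.varEnc w).size ≤ (x c.1.1).enc.size := fun w =>
      (Data.size_le_of_mem (List.mem_ofFn.2 ⟨w, rfl⟩)).le.trans hlist
    have key : ∀ g : Fin (x c.1.1).M.numVars → Data,
        (∀ w, (g w).size ≤ (x c.1.1).enc.size + (C + 10)) →
          (Data.ofList ((List.ofFn g).take c.1.2).reverse).size ≤
            (x c.1.1).enc.size * ((x c.1.1).enc.size + (C + 10) + 1) + 1 := by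
      intro g hg
      rw [Data.size_ofList_reverse]
      refine (Data.size_ofList_le_of_forall (B := (x c.1.1).enc.size + (C + 10))
        fun d hd => ?_).trans ?_
      · obtain ⟨w, rfl⟩ := List.mem_ofFn.1 (List.mem_of_mem_take hd)
        exact hg w
      · rw [List.length_take]
        gcongr
        exact (min_le_left _ _).trans hn
    have h₁ := key ((x c.1.1).fixVarEnc ((x c.1.1).greedy (q c.1.1))) fun w => by
      have h₂ := hvar w
      unfold fixVarEnc
      split
      · have h₃ := hrule w ‹_›
        have h₄ := ((x c.1.1).M.node w).enc.size_pos
        simp only [varEnc, fixedVarEnc, Data.ofList, Data.size, Data.size_unary] at h₂ ⊢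
        omega
      · omega
    have h₂ := key ((x c.1.1).outEnc ((x c.1.1).greedy (q c.1.1))) fun w => by
      unfold outEnc
      split
      · have h₃ := hrule w ‹_›
        omega
      · simp only [Data.size]
        omega
    simp only [Data.size]
    omega
  · intro I hhead hrest he hacc
    let B := {c : β × ℕ // c.2 < (List.ofFn (x c.1).M.varEnc).length}
    let w : (c : B) → Fin (x c.1.1).M.numVars := fun c => ⟨c.1.2, by simpa using c.2⟩
    have hw : PolyTimeFun I fun c => (x c.1.1).M.varEnc (w c) :=
      hhead.congr_fun fun c => by rw [List.getElem_ofFn]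
    have htake : ∀ (c : B) (g : Fin (x c.1.1).M.numVars → Data),
        ((List.ofFn g).take (c.1.2 + 1)).reverse =
          g (w c) :: ((List.ofFn g).take c.1.2).reverse := fun c g => by
      have hc : c.1.2 < (List.ofFn g).length := by simpa using c.2
      rw [← List.take_concat_get' _ _ hc, List.getElem_ofFn]
      simp [w]
    -- The search for a rule is computable only at decisions of the agent, so it is called on this
    -- subtype after the kind of the variable has been tested.
    let D := {c : B // (x c.1.1).M.node (w c) = .decision (x c.1.1).i}
    refine PolyTimePred.cases (polyTimePred_isDecision (x := fun c : B => x c.1.1) hw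
      he.snd.tail.head) ?_ ?_
    · have hT := polyTimeFun_greedy (x := fun c : D => x c.1.1.1)
        (v := fun c => w c.1) (q := fun c => q c.1.1.1) hfix hbdd oracle
        (fun c => hvalid c.1.1.1) (fun c => c.2) (fun c => hqq c.1.1.1)
        (he.fst.precomp _) (he.snd.precomp _) (hw.precomp _) (hacc.fst.precomp _)
        (hrest.precomp _)
      have hw' := hw.precomp (Subtype.val : D → B)
      have hacc' := hacc.precomp (Subtype.val : D → B)
      refine (((hw'.head.cons (hw'.tail.head.cons ((PolyTimeFun.nil.cons (hT.cons .nil)).cons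
        .nil))).cons hacc'.fst).cons (hT.cons hacc'.snd)).congr_fun fun c => ?_
      rw [htake, htake, fixVarEnc, outEnc, if_pos c.2, if_pos c.2]
      rfl
    · refine (((hw.precomp Subtype.val).cons (hacc.precomp Subtype.val).fst).cons
        (PolyTimeFun.nil.cons (hacc.precomp Subtype.val).snd)).congr_fun fun c => ?_
      rw [htake, htake, fixVarEnc, outEnc, if_neg c.2, if_neg c.2]
      rfl

end BestResponseInput

theorem proposition7 (k b : ℕ) (𝒞 : (M : MAID) → Fin M.numAgents → Prop)
    (h𝒞 : ClosedUnderFixing 𝒞)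
    (hIBR : PolyTimeDecidable IsBestResponseInput.enc
      (fun x => 𝒞 x.M x.i ∧ x.M.BoundedDecisions x.i k b)
      IsBestResponseInput.question) :
    PolyTimeSolvable (α := BestResponseInput) (β := fun x => x.M.RatPolicy x.i)
      BestResponseInput.enc
      (fun _ π => MAID.RatPolicy.enc π)
      (fun x => 𝒞 x.M x.i ∧ x.M.BoundedDecisions x.i k b)
      (fun x π => MAID.IsBestResponse (MAID.RatPolicy.toReal π)
        (MAID.RatPartialProfile.toReal x.π)) := by
  classical
  let valid : BestResponseInput → Prop := fun x => 𝒞 x.M x.i ∧ x.M.BoundedDecisions x.i k b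
  have oracle : PolyTimePred
      (fun y : {y : IsBestResponseInput // valid y.toBestResponseInput} => y.1.enc)
      fun y => y.1.question := by
    obtain ⟨p, P, h⟩ := hIBR
    choose e he using fun y : {y : IsBestResponseInput // valid y.toBestResponseInput} =>
      h y.1 y.2
    exact (PolyTimePred.isNil (PolyTimeFun.of_computes fun y => (he y).1)).not.congr
      fun y => (he y).2
  -- One exponent serves twice: 2 ^ L exceeds the absolute value of the optimum, and 2 ^ (-L) is at
  -- most the spacing 1 / D of the values of pure policies.
  let L : {x // valid x} → ℕ := fun x => 2 * x.1.enc.size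
  have hL : PolyTimeFun (fun x : {x // valid x} => x.1.enc) fun x => .unary (L x) :=
    (PolyTimeFun.id.unary_size.unary_add PolyTimeFun.id.unary_size).congr_fun fun x => by
      rw [← two_mul]
  let q : {x // valid x} → Frac := fun x => searchBound x.1.optimum (L x) (2 * L x)
  have hq : PolyTimeFun (fun x : {x // valid x} => x.1.enc) fun x => (q x).enc :=
    PolyTimeFun.searchBound_enc hL <|
      (oracle.precomp fun b : {x // valid x} × Frac => ⟨⟨b.1.1, b.2⟩, b.1.2⟩).congr fun b =>
        BestResponseInput.question_iff_lt_optimum b.2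
  have hspec : ∀ x, (q x).toReal < x.1.optimum ∧
      x.1.optimum ≤ (q x).toReal + 1 / 2 ^ L x := fun x => by
    simpa using searchBound_spec (L := L x) BestResponseInput.abs_optimum_lt (le_refl (2 * L x))
  have hqq : ∀ x : {x // valid x}, (IsBestResponseInput.mk x.1 (q x)).question := fun x =>
    (BestResponseInput.question_iff_lt_optimum _).2 (hspec x).1
  obtain ⟨p, P, hp⟩ := (BestResponseInput.polyTimeFun_policy (x := Subtype.val) (k := k) (b := b)
    (fun x hx F n => ⟨BestResponseInput.closed_fixBelow h𝒞 hx.1 F n,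
      BestResponseInput.boundedDecisions_fixBelow hx.2 F n⟩) (fun x hx => hx.2) oracle
    (fun x => x.2) hqq hq PolyTimeFun.id).computes
  refine ⟨p, P, fun x hx => ⟨fun v _ c => RatDist.pure (x.greedy (q ⟨x, hx⟩) v c), ?_, ?_⟩⟩
  · exact BestResponseInput.isBestResponse_of_lt
      (BestResponseInput.lt_value_greedy (hqq ⟨x, hx⟩)) (hspec ⟨x, hx⟩).2
  · convert hp ⟨x, hx⟩ using 1
    unfold MAID.RatPolicy.enc BestResponseInput.outEnc
    congr 2
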